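/- Let $n\ge 1$, $a_1,\dots,a_n,b_1,\dots,b_n,c_1,\dots,c_n,\beta\in\mathbb{R}$. Let $A\in\mathbb{R}^{n\times n}$ be the matrix with $I_{n-1}$ in the lower-left block (rows $2,\dots,n$, columns $1,\dots,n-1$), last column $[-a_n\ \cdots\ -a_1]^\top$, and zeros elsewhere; let $B=[b_n\ \cdots\ b_1]^\top$ and $C=[0_{1,n-1}\ \ 1]$. Let $A_{\mathrm r}\in\mathbb{R}^{n\times n}$ be the matrix with $I_{n-1}$ in the upper-right block (rows $1,\dots,n-1$, columns $2,\dots,n$), last row $[-c_n\ \cdots\ -c_1]$, and zeros elsewhere; let $B_{\mathrm r}=[0_{1,n-1}\ \ 1]^\top$. Let $\lambda(\cdot)$ denote the complex spectrum. Consider the system $$\dot x=Ax+Bu,\quad y=Cx,\quad x(0)=x_0,$$ with arbitrary $x_0\in\mathbb{R}^n$, interconnected with the filters $$\dot\zeta=A_{\mathrm r}\zeta+B_{\mathrm r}u,\quad \dot\mu=A_{\mathrm r}\mu+B_{\mathrm r}y,\quad \dot\phi=-\beta\phi+\mathrm{col}(\zeta,\mu),\quad \dot\upsilon=-\beta\upsilon+u,$$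 with $\zeta(0)=\mu(0)=0\in\mathbb{R}^n$, $\phi(0)=0\in\mathbb{R}^{2n}$, $\upsilon(0)=0\in\mathbb{R}$. Assume that (i) $s^n+a_1s^{n-1}+\dots+a_n$ and $b_1s^{n-1}+\dots+b_n$ have no common complex root; (ii) $-\beta\notin\lambda(A_{\mathrm r})$; (iii) $s^n+a_1s^{n-1}+\dots+a_n$ and $s^n+c_1s^{n-1}+\dots+c_n$ have no common complex root. Let $T_S>0$ be such that there are no $\ell\in\{-\beta\}\cup\lambda(A)\cup\lambda(A_{\mathrm r})$ and $h\in\mathbb{Z}\setminus\{0\}$ with $\ell+\imath 2h\pi T_S^{-1}\in\{-\beta\}\cup\lambda(A)\cup\lambda(A_{\mathrm r})$. Let $N\ge 8n+4$ and $t_k=kT_S$. Let $W_N\in\mathbb{R}^{N\times(N-n-1)}$ be the lower triangular Toeplitz matrix with first column $[w_{n+1}\ \cdots\ w_1\ w_0\ 0_{1,N-n-2}]^\top$, where $$w_0z^{n+1}+w_1z^n+\dots+w_{n+1}=(z-\mathrm e^{-\beta T_S})\det(zI-\mathrm e^{A_{\mathrm r}^\top T_S}).$$ Apply the input $u(t)=d_k$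 for $t\in[kT_S,(k+1)T_S)$, $k\in\{0,\dots,N-1\}$, and suppose that $\{d_k\}_{k=1}^{N-1}\subset\mathbb{R}$ is persistently exciting of order $4n+2$, i.e. its Hankel matrix of depth $4n+2$ has rank $4n+2$. Then the equation $\Gamma A_{\mathrm r}^\top+\beta\Gamma=G_{\mathrm f}$, where $G_{\mathrm f}\in\mathbb{R}^{2n\times n}$ has last row $[0_{1,n-1}\ \ 1]$ and zeros elsewhere, has a unique solution $\Gamma^\star\in\mathbb{R}^{2n\times n}$ and, with $$\epsilon(t)=\Gamma^\star(\mathrm e^{A_{\mathrm r}^\top t}-\mathrm e^{-\beta t}I_n)x_0,\quad E_N=[\epsilon(t_1)\ \cdots\ \epsilon(t_N)],\quad \Phi_N=[\phi(t_1)\ \cdots\ \phi(t_N)],\quad \Upsilon_N=[\upsilon(t_1)\ \cdots\ \upsilon(t_N)],$$ one has $$E_NW_N=0\quad\text{and}\quad \mathrm{rank}\,\big(\mathrm{col}(\Phi_NW_N,\Upsilon_NW_N)\big)=2n+1.$$ In particular, there are $\bar N\in\mathbb{N}$ and $W\in\mathbb{R}^{N\times\bar N}$ such that $E_NW=0$ and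 $\mathrm{rank}\,(\mathrm{col}(\Phi_NW,\Upsilon_NW))=2n+1$. -/

import Mathlib

open Matrix Polynomial Set

namespace FilteredData

noncomputable section

/-- The monic polynomial `s ^ n + a₁ s ^ (n-1) + ⋯ + aₙ`; the coefficient `aᵢ` is stored as
`a (i - 1)`. -/
def monicPoly {n : ℕ} (a : Fin n → ℝ) : ℝ[X] :=
  X ^ n + ∑ i : Fin n, C (a i) * X ^ (n - 1 - (i : ℕ))

/-- The polynomial `b₁ s ^ (n-1) + ⋯ + bₙ`; the coefficient `bᵢ` is stored as `b (i - 1)`. -/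
def numPoly {n : ℕ} (b : Fin n → ℝ) : ℝ[X] :=
  ∑ i : Fin n, C (b i) * X ^ (n - 1 - (i : ℕ))

/-- Two real polynomials are coprime if they have no common (complex) root. -/
def NoCommonRoot (p q : ℝ[X]) : Prop :=
  ∀ z : ℂ, ¬ (aeval z p = 0 ∧ aeval z q = 0)

/-- The spectrum of a real square matrix, as a set of complex numbers. -/
def complexSpectrum {n : ℕ} (M : Matrix (Fin n) (Fin n) ℝ) : Set ℂ :=
  spectrum ℂ (M.map (fun r : ℝ => (r : ℂ)))

/-- The matrix with identity block above the diagonal and last row `[-cₙ ⋯ -c₁]`. -/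
def filterA {n : ℕ} (c : Fin n → ℝ) : Matrix (Fin n) (Fin n) ℝ :=
  Matrix.of fun i j =>
    if (i : ℕ) + 1 = n then -c (Fin.rev j) else if (j : ℕ) = (i : ℕ) + 1 then 1 else 0

/-- The last vector of the standard basis (`B_r`, and also, read as a row, `C`). -/
def lastVec (n : ℕ) : Fin n → ℝ :=
  fun i => if (i : ℕ) + 1 = n then 1 else 0

/-- The system matrix in observability canonical form: identity block below the diagonal and
last column `[-aₙ ⋯ -a₁]ᵀ`. -/
def systemA {n : ℕ} (a : Fin n → ℝ) : Matrix (Fin n) (Fin n) ℝ :=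
  Matrix.of fun i j =>
    if (j : ℕ) + 1 = n then -a (Fin.rev i) else if (i : ℕ) = (j : ℕ) + 1 then 1 else 0

/-- The input vector `[bₙ ⋯ b₁]ᵀ` of the system. -/
def systemB {n : ℕ} (b : Fin n → ℝ) : Fin n → ℝ :=
  fun i => b (Fin.rev i)

/-- The `2n × n` matrix whose last row is `[0 ⋯ 0 1]` and whose other entries are zero. -/
def disturbanceG (n : ℕ) : Matrix (Fin n ⊕ Fin n) (Fin n) ℝ :=
  Matrix.fromRows 0 (Matrix.vecMulVec (lastVec n) (lastVec n))

/-- `z` solves `z' = f` on `[0, τ]`, for a right-hand side `f` that is piecewise continuous and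
continuous from the right: `z` is continuous on `[0, τ]` and its right derivative is `f t` at
every `t ∈ [0, τ)`. For such right-hand sides this is the same as solving the integral equation
`z t = z 0 + ∫ f`. -/
def SolvesOn {E : Type*} [NormedAddCommGroup E] [NormedSpace ℝ E]
    (τ : ℝ) (z f : ℝ → E) : Prop :=
  ContinuousOn z (Icc 0 τ) ∧ ∀ t ∈ Ico 0 τ, HasDerivWithinAt z (f t) (Ici t) t

/-- Trajectory on `[0, τ]`, with input `u`, of the system `x' = A x + B u`, `y = C x` started
at `x₀`, interconnected with the filters `ζ' = A_r ζ + B_r u`, `μ' = A_r μ + B_r y`,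
`φ' = -β φ + col(ζ, μ)`, `υ' = -β υ + u`, all started at zero. -/
structure IsTrajectory {n : ℕ} (a b c : Fin n → ℝ) (β τ : ℝ) (x₀ : Fin n → ℝ) (u : ℝ → ℝ)
    (x ζ μ : ℝ → Fin n → ℝ) (φ : ℝ → Fin n ⊕ Fin n → ℝ) (υ : ℝ → ℝ) : Prop where
  x_init : x 0 = x₀
  x_ode : SolvesOn τ x fun t => systemA a *ᵥ x t + u t • systemB b
  ζ_init : ζ 0 = 0
  ζ_ode : SolvesOn τ ζ fun t => filterA c *ᵥ ζ t + u t • lastVec n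
  μ_init : μ 0 = 0
  μ_ode : SolvesOn τ μ fun t => filterA c *ᵥ μ t + (lastVec n ⬝ᵥ x t) • lastVec n
  φ_init : φ 0 = 0
  φ_ode : SolvesOn τ φ fun t => -β • φ t + Sum.elim (ζ t) (μ t)
  υ_init : υ 0 = 0
  υ_ode : SolvesOn τ υ fun t => -β * υ t + u t

/-- The Hankel matrix of depth `L` of the scalar sequence `s₁, …, s_M`. -/
def hankelMatrix (L M : ℕ) (s : ℕ → ℝ) : Matrix (Fin L) (Fin (M + 1 - L)) ℝ :=
  Matrix.of fun i j => s ((i : ℕ) + (j : ℕ) + 1)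

/-- The scalar sequence `s₁, …, s_M` is persistently exciting of order `L`. -/
def PersistentlyExciting (L M : ℕ) (s : ℕ → ℝ) : Prop :=
  (hankelMatrix L M s).rank = L

/-- The set `{-β} ∪ λ(A) ∪ λ(A_r)`. -/
def modes {n : ℕ} (a c : Fin n → ℝ) (β : ℝ) : Set ℂ :=
  {-(β : ℂ)} ∪ complexSpectrum (systemA a) ∪ complexSpectrum (filterA c)

/-- The sampling time `T` is non-pathological: no two elements of the set `S` differ by a
nonzero integer multiple of `2 π i / T`. -/
def NonPathological (S : Set ℂ) (T : ℝ) : Prop :=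
  ¬ ∃ l ∈ S, ∃ h : ℤ, h ≠ 0 ∧ l + Complex.I * (2 * (h : ℂ) * (Real.pi : ℂ)) * (T : ℂ)⁻¹ ∈ S

/-- The polynomial `(z - exp (-β T)) det (z I - exp (A_rᵀ T)) = w₀ z ^ (n+1) + ⋯ + w_{n+1}`. -/
def firPoly {n : ℕ} (c : Fin n → ℝ) (β T : ℝ) : ℝ[X] :=
  (X - C (Real.exp (-β * T))) * (NormedSpace.exp (T • (filterA c)ᵀ)).charpoly

/-- The coefficients `w₀, w₁, …, w_{n+1}`, the leading one first. -/
def firCoeff {n : ℕ} (c : Fin n → ℝ) (β T : ℝ) (i : ℕ) : ℝ :=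
  (firPoly c β T).coeff (n + 1 - i)

/-- The `N × (N-n-1)` lower triangular Toeplitz matrix with first column
`[w_{n+1} ⋯ w₁ w₀ 0 ⋯ 0]ᵀ`. -/
def firMatrix {n : ℕ} (c : Fin n → ℝ) (β T : ℝ) (N : ℕ) :
    Matrix (Fin N) (Fin (N - n - 1)) ℝ :=
  Matrix.of fun i j =>
    if (j : ℕ) ≤ i ∧ (i : ℕ) - j ≤ n + 1 then firCoeff c β T (n + 1 - ((i : ℕ) - j)) else 0

/-- The matrix `[f(t₁) ⋯ f(t_N)]` of the samples of `f` at `t_k = k T`, `k = 1, …, N`. -/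
def sampleMatrix {ι : Type*} (N : ℕ) (T : ℝ) (f : ℝ → ι → ℝ) : Matrix ι (Fin N) ℝ :=
  Matrix.of fun i k => f (((k : ℕ) + 1 : ℝ) * T) i

/-- The signal `ε(t) = Γ (exp (A_rᵀ t) - exp (-β t) I) x₀`. -/
def epsSignal {n : ℕ} (c : Fin n → ℝ) (β : ℝ) (Γ : Matrix (Fin n ⊕ Fin n) (Fin n) ℝ)
    (x₀ : Fin n → ℝ) (t : ℝ) : Fin n ⊕ Fin n → ℝ :=
  (Γ * (NormedSpace.exp (t • (filterA c)ᵀ) - Real.exp (-β * t) • 1)) *ᵥ x₀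

/-- `W` annihilates the disturbance data `E`, and the filtered data matrix
`col(Φ W, Υ W)` has rank `2 n + 1`. -/
def RankConditionWith {n N Nbar : ℕ} (E Φ : Matrix (Fin n ⊕ Fin n) (Fin N) ℝ)
    (Υ : Matrix Unit (Fin N) ℝ) (W : Matrix (Fin N) (Fin Nbar) ℝ) : Prop :=
  E * W = 0 ∧ (Matrix.fromRows (Φ * W) (Υ * W)).rank = 2 * n + 1

/-- The rank condition holds for some matrix `W`, with any number of columns. -/
def RankCondition {n N : ℕ} (E Φ : Matrix (Fin n ⊕ Fin n) (Fin N) ℝ)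
    (Υ : Matrix Unit (Fin N) ℝ) : Prop :=
  ∃ (Nbar : ℕ) (W : Matrix (Fin N) (Fin Nbar) ℝ), RankConditionWith E Φ Υ W

end

end FilteredData

/-!
The disturbance part `E W = 0` is the Cayley-Hamilton theorem: the polynomial `p` of the filter `W`
annihilates both exponentials occurring in the samples of `ε`
(`sampleMatrix_epsSignal_mul_firMatrix`). The matrix `Γ` is `G_f (A_rᵀ + β I)⁻¹`.

For the rank, let a row vector `v` annihilate the filtered data; one has to show `v = 0`. The system,
the filters and the held input form one autonomous system `s' = M s` on each sampling interval, so
that the sampled states satisfy `ξ (k+1) = F ξ k + d k G` with `F = exp (T M)` and `G = F e - e`,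
where `e` is the unit input. The hypothesis on `v` is that the output `H ξ` defined by `v` satisfies
the recurrence with polynomial `p`. Since `M` is block triangular, a multiple of `p` of degree
`3 n + 3 ≤ 4 n + 2` annihilates `F` (`aeval_exp_generator`). The recurrence of that multiple no longer
involves the state, only the inputs, and persistency of excitation makes its coefficients vanish; as
the polynomial is monic, all Markov parameters `H F ^ j G` vanish (`markov_eq_zero`), and hence so do
the samples `H F ^ k e`.

Nonpathological sampling then gives `H M ^ j e = 0` for all `j`
(`apply_pow_eq_zero_of_sampled`): for a mode `l` the operator `exp (T M) - exp (T l)` is `M - l` times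
an invertible operator, because `(exp (T z) - exp (T l)) / (z - l)` has no zero at a mode.

It remains to see that the continuous-time responses of `φ` and `υ` to the input are linearly
independent (`eq_zero_of_outputRow`). The components `φ` and `υ` reduce to `ζ` and `μ` by applying
`M + β`. As `A` and `A_r` have no common eigenvalue, the solution `P` of the Sylvester equation
`P A - A_r P = B_r C` decouples `μ - P x` from `x`; namely `P = O c(A)⁻¹` with the
observability matrix `O` of `(A, C)`. Testing with multiples of the characteristic polynomial `c` of
`A_r` leaves `v₂ᵀ O r(A) B = 0` for all polynomials `r`, and the controllability of `(A, B)`, which is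
the coprimeness of numerator and denominator, together with the invertibility of `O` gives `v₂ = 0`.
The controllability of `(A_r, B_r)` then gives `v₁ = 0` (`eq_zero_of_filter_response`).
-/

namespace FilteredData

/-! ### Exponentials of operators -/

section Exponential

open NormedSpace

variable {𝕜 E W : Type*} [RCLike 𝕜] [NormedAddCommGroup E] [NormedSpace 𝕜 E]
  [NormedAddCommGroup W] [NormedSpace 𝕜 W]

lemma comp_pow_of_comp_eq {K : E →L[𝕜] W} {M : E →L[𝕜] E} {A : W →L[𝕜] W}
    (h : K ∘L M = A ∘L K) (n : ℕ) : K ∘L (M ^ n) = (A ^ n) ∘L K := by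
  induction n with
  | zero => rfl
  | succ n ih =>
    calc K ∘L (M ^ (n + 1)) = (K ∘L (M ^ n)) ∘L M := by rw [pow_succ]; rfl
      _ = (A ^ n) ∘L (K ∘L M) := by rw [ih]; rfl
      _ = (A ^ (n + 1)) ∘L K := by rw [h, pow_succ]; rfl

lemma pow_apply_of_eigenvector {M : E →L[𝕜] E} {κ : 𝕜} {v : E} (h : M v = κ • v) (n : ℕ) :
    (M ^ n) v = κ ^ n • v := by
  induction n with
  | zero => simp
  | succ n ih => rw [pow_succ, mul_apply_eq_comp, h, map_smul, ih, smul_smul, pow_succ']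

variable [CompleteSpace E] [CompleteSpace W]

/-- A linear map intertwining two operators intertwines their exponentials. -/
lemma comp_exp_of_comp_eq {K : E →L[𝕜] W} {M : E →L[𝕜] E} {A : W →L[𝕜] W}
    (h : K ∘L M = A ∘L K) : K ∘L exp M = exp A ∘L K := by
  have h1 := (exp_series_hasSum_exp' (𝕂 := 𝕜) M).mapL (ContinuousLinearMap.compL 𝕜 E E W K)
  have h2 := (exp_series_hasSum_exp' (𝕂 := 𝕜) A).mapL ((ContinuousLinearMap.compL 𝕜 E W W).flip K)
  refine h1.unique (h2.congr_fun ?_)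
  intro n
  simp only [map_smul, ContinuousLinearMap.compL_apply, ContinuousLinearMap.flip_apply,
    comp_pow_of_comp_eq h]

lemma exp_apply_of_eigenvector {M : E →L[𝕜] E} {κ : 𝕜} {v : E} (h : M v = κ • v) :
    exp M v = exp κ • v := by
  have h1 := (exp_series_hasSum_exp' (𝕂 := 𝕜) M).mapL (ContinuousLinearMap.apply 𝕜 E v)
  have h2 := (exp_series_hasSum_exp' (𝕂 := 𝕜) κ).smul_const v
  refine h1.unique (h2.congr_fun ?_)
  intro n
  simp only [map_smul, ContinuousLinearMap.apply_apply, pow_apply_of_eigenvector h, smul_assoc]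

/-- The entire function `(exp z - 1) / z` evaluated at an element of a Banach algebra. -/
lemma exists_hasSum_exp_sub_one {𝔸 : Type*} [NormedRing 𝔸] [NormedAlgebra 𝕜 𝔸] [CompleteSpace 𝔸]
    (a : 𝔸) : ∃ ψ : 𝔸, HasSum (fun n : ℕ => ((n + 1).factorial⁻¹ : 𝕜) • a ^ n) ψ ∧
      exp a = 1 + ψ * a ∧ exp a = 1 + a * ψ := by
  have hb : Summable fun n : ℕ => ((n + 1).factorial⁻¹ : 𝕜) • a ^ n := by
    refine .of_norm_bounded_eventually (Real.summable_pow_div_factorial ‖a‖) ?_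
    filter_upwards [Filter.eventually_cofinite_ne 0] with n hn
    rw [norm_smul, mul_comm, norm_inv, RCLike.norm_natCast, ← div_eq_mul_inv]
    gcongr
    · exact norm_pow_le' _ (pos_iff_ne_zero.mpr hn)
    · exact n.le_succ
  have hexp : HasSum (fun n : ℕ => ((n + 1).factorial⁻¹ : 𝕜) • a ^ (n + 1)) (exp a - 1) := by
    have := (hasSum_nat_add_iff' 1).2 (exp_series_hasSum_exp' (𝕂 := 𝕜) a)
    simpa using this
  refine ⟨_, hb.hasSum, ?_, ?_⟩
  · rw [← sub_eq_iff_eq_add']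
    refine hexp.unique ((hb.hasSum.mul_right a).congr_fun fun n => ?_)
    simp [pow_succ]
  · rw [← sub_eq_iff_eq_add']
    refine hexp.unique ((hb.hasSum.mul_left a).congr_fun fun n => ?_)
    simp [pow_succ']

end Exponential

/-! ### Nonpathological sampling over the complex numbers -/

section Sampling

open NormedSpace

variable {E : Type*} [NormedAddCommGroup E] [NormedSpace ℂ E] [FiniteDimensional ℂ E]

/-- The operator `ψ = (exp a - 1) / a`, `a = T (K - l)`, is injective, as it could only fail to be so
on an eigenvector of `K` for an eigenvalue `κ ≠ l` with `exp (T κ) = exp (T l)`. -/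
lemma injective_of_nonresonant [CompleteSpace E] {K : E →L[ℂ] E} {T l : ℂ}
    (hl : ∀ (κ : ℂ) (v : E), v ≠ 0 → K v = κ • v → Complex.exp (T * κ) = Complex.exp (T * l) →
      κ = l)
    {ψ : E →L[ℂ] E}
    (hψ : HasSum (fun n : ℕ => ((n + 1).factorial⁻¹ : ℂ) • (T • (K - l • 1)) ^ n) ψ)
    (hcomm : Commute ψ K)
    (hψe' : exp (T • (K - l • 1)) = 1 + (T • (K - l • 1)) * ψ) :
    Function.Injective ψ := by
  rw [injective_iff_map_eq_zero]
  by_contra! hne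
  obtain ⟨w, hw, hw0⟩ := hne
  set N : Submodule ℂ E := LinearMap.ker (ψ : E →ₗ[ℂ] E) with hN
  have hNK : ∀ v ∈ N, (K : E →ₗ[ℂ] E) v ∈ N := by
    intro v hv
    have hv' : ψ v = 0 := hv
    change ψ (K v) = 0
    have := congrArg (fun L : E →L[ℂ] E => L v) hcomm.eq
    simp only [mul_apply_eq_comp] at this
    rw [this, hv', map_zero]
  have : Nontrivial N := ⟨⟨⟨w, hw⟩, 0, fun h => hw0 (congrArg Subtype.val h)⟩⟩
  obtain ⟨κ, hκ⟩ := Module.End.exists_eigenvalue ((K : E →ₗ[ℂ] E).restrict hNK)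
  obtain ⟨v, hv⟩ := hκ.exists_hasEigenvector
  have hv0 : (v : E) ≠ 0 := fun h => hv.2 (Subtype.ext h)
  have hKv : K v = κ • (v : E) := congrArg Subtype.val hv.apply_eq_smul
  have hψv : ψ v = 0 := v.2
  have hav : (T • (K - l • 1)) (v : E) = (T * (κ - l)) • (v : E) := by
    simp [hKv, sub_smul, mul_smul, smul_sub, mul_sub]
  have hev : exp (T * (κ - l)) • (v : E) = (v : E) := by
    rw [← exp_apply_of_eigenvector hav, hψe']
    simp [hψv]
  have he1 : Complex.exp (T * (κ - l)) = 1 := by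
    rw [Complex.exp_eq_exp_ℂ]
    exact smul_left_injective ℂ hv0 (by simpa using hev)
  have hκl : κ = l := by
    refine hl κ v hv0 hKv ?_
    rw [mul_sub, Complex.exp_sub, div_eq_one_iff_eq (Complex.exp_ne_zero _)] at he1
    exact he1
  have hav0 : (T • (K - l • 1)) (v : E) = 0 := by rw [hav, hκl]; simp
  have h1 := hψ.mapL (ContinuousLinearMap.apply ℂ E (v : E))
  have h2 : HasSum (fun n : ℕ => ContinuousLinearMap.apply ℂ E (v : E)
      (((n + 1).factorial⁻¹ : ℂ) • (T • (K - l • 1)) ^ n)) (v : E) := by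
    have h3 := hasSum_single (f := fun n : ℕ => ContinuousLinearMap.apply ℂ E (v : E)
      (((n + 1).factorial⁻¹ : ℂ) • (T • (K - l • 1)) ^ n)) 0 (by
        intro n hn
        obtain ⟨m, rfl⟩ := Nat.exists_eq_succ_of_ne_zero hn
        simp only [map_smul, ContinuousLinearMap.apply_apply, Nat.succ_eq_add_one, pow_succ,
          mul_apply_eq_comp, hav0, map_zero, smul_zero])
    simpa using h3
  exact hv0 ((h2.unique h1).trans hψv)

/-- Nonpathological sampling preserves observability: if `T` separates the exponentials of the modes
in `S`, then a functional that vanishes on the samples `exp (k T K) h` vanishes on all `K ^ j h`.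
The proof removes one mode `l` at a time: `exp (T K) - exp (T l)` is `K - l` times an operator that
is invertible on every `K`-invariant subspace. -/
theorem apply_pow_eq_zero_of_sampled {K : E →L[ℂ] E} {T : ℂ} (hT : T ≠ 0) {S : Set ℂ}
    (hS : ∀ l ∈ S, ∀ κ ∈ S, Complex.exp (T * κ) = Complex.exp (T * l) → κ = l)
    (hK : ∀ (κ : ℂ) (v : E), v ≠ 0 → K v = κ • v → κ ∈ S)
    (ℓ : E →L[ℂ] ℂ) (s : Multiset ℂ) (hs : ∀ l ∈ s, l ∈ S) (h : E)
    (hh : aeval K (s.map fun l => X - C l).prod h = 0)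
    (hℓ : ∀ k : ℕ, ℓ ((exp (T • K) ^ k) h) = 0) (j : ℕ) : ℓ ((K ^ j) h) = 0 := by
  have : CompleteSpace E := FiniteDimensional.complete ℂ E
  induction s using Multiset.induction generalizing h j with
  | empty =>
    have : h = 0 := by simpa using hh
    simp [this]
  | cons l s ih =>
    have hlS : l ∈ S := hs l (Multiset.mem_cons_self l s)
    set a : E →L[ℂ] E := T • (K - l • 1) with ha
    obtain ⟨ψ, hψ, hψe, hψe'⟩ := exists_hasSum_exp_sub_one (𝕜 := ℂ) a
    have hKψ : Commute ψ K := by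
      have h3 := add_left_cancel (hψe.symm.trans hψe')
      rw [ha, smul_mul_assoc, mul_smul_comm] at h3
      have h4 : ψ * K = K * ψ := by
        simpa [sub_mul, mul_sub] using smul_right_injective _ hT h3
      exact h4
    have hinj : Function.Injective ψ :=
      injective_of_nonresonant (fun κ v hv hv' => hS l hlS κ (hK κ v hv hv')) hψ hKψ hψe'
    -- `U` is the largest `K`-invariant subspace on which `ℓ` vanishes.
    let U : Submodule ℂ E := ⨅ j : ℕ, LinearMap.ker ((ℓ ∘L (K ^ j) : E →L[ℂ] ℂ) : E →ₗ[ℂ] ℂ)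
    have hU : ∀ g, g ∈ U ↔ ∀ j : ℕ, ℓ ((K ^ j) g) = 0 := by
      intro g
      simp only [U, Submodule.mem_iInf]
      rfl
    have hUK : ∀ g ∈ U, K g ∈ U := by
      intro g hg
      rw [hU] at hg ⊢
      intro j
      have := hg (j + 1)
      rwa [pow_succ, mul_apply_eq_comp] at this
    have hUa : ∀ g ∈ U, ∀ n : ℕ, (a ^ n) g ∈ U := by
      intro g hg n
      induction n with
      | zero => simpa using hg
      | succ n ihn =>
        rw [pow_succ', mul_apply_eq_comp]
        have : a ((a ^ n) g) = T • (K ((a ^ n) g) - l • (a ^ n) g) := by simp [ha]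
        rw [this]
        exact U.smul_mem _ (U.sub_mem (hUK _ ihn) (U.smul_mem _ ihn))
    have hUψ : ∀ g ∈ U, (ψ : E →ₗ[ℂ] E) g ∈ U := by
      intro g hg
      rw [hU]
      intro j
      have h1 := (hψ.mapL (ContinuousLinearMap.apply ℂ E g)).mapL (ℓ ∘L (K ^ j))
      refine h1.unique (hasSum_zero.congr_fun ?_)
      intro n
      have := (hU _).1 (hUa g hg n) j
      rw [map_smul, map_smul, ContinuousLinearMap.apply_apply, ContinuousLinearMap.comp_apply, this,
        smul_zero]
    have hψU : Function.Surjective ((ψ : E →ₗ[ℂ] E).restrict hUψ) := by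
      rw [← LinearMap.injective_iff_surjective]
      intro g g' hgg'
      exact Subtype.ext (hinj (congrArg Subtype.val hgg'))
    have hcomm : Commute (algebraMap ℂ (E →L[ℂ] E) (T * l)) a := Algebra.commutes _ _
    have hexp : exp (T • K) = Complex.exp (T * l) • exp a := by
      let +nondep : NormedAlgebra ℚ (E →L[ℂ] E) := .restrictScalars ℚ ℂ _
      have h1 : T • K = algebraMap ℂ (E →L[ℂ] E) (T * l) + a := by
        rw [ha, Algebra.algebraMap_eq_smul_one, smul_sub, smul_smul]; abel
      rw [h1, exp_add_of_commute hcomm, ← algebraMap_exp_comm, ← Complex.exp_eq_exp_ℂ,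
        Algebra.algebraMap_eq_smul_one, smul_mul_assoc, one_mul]
    set g : E := K h - l • h with hg
    have hFh : exp (T • K) h = Complex.exp (T * l) • h + (Complex.exp (T * l) * T) • ψ g := by
      rw [hexp, hψe]
      have : a h = T • g := by simp [ha, hg]
      simp [this, mul_smul]
    have hψg : ψ g ∈ U := by
      rw [hU]
      refine ih (fun l' hl' => hs l' (Multiset.mem_cons_of_mem hl')) (ψ g) ?_ ?_
      · have hK1 : aeval K (X - C l) h = g := by
          simp [hg, Algebra.algebraMap_eq_smul_one]
        rw [Multiset.map_cons, Multiset.prod_cons, mul_comm, map_mul,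
          mul_apply_eq_comp, hK1] at hh
        have hc : Commute ψ (aeval K (s.map fun l => X - C l).prod) := by
          have : (aeval K (s.map fun l => X - C l).prod) ∈ Algebra.adjoin ℂ {K} :=
            aeval_mem_adjoin_singleton ℂ K
          exact Algebra.commute_of_mem_adjoin_singleton_of_commute this hKψ
        have := congrArg (fun L : E →L[ℂ] E => L g) hc.eq
        simp only [mul_apply_eq_comp] at this
        rw [← this, hh, map_zero]
      · intro k
        have h1 := hℓ (k + 1)
        rw [pow_succ, mul_apply_eq_comp, hFh, map_add, map_add, map_smul, map_smul,
          hℓ k, map_smul, map_smul, smul_zero, zero_add, smul_eq_zero] at h1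
        exact h1.resolve_left (mul_ne_zero (Complex.exp_ne_zero _) hT)
    have hgU : g ∈ U := by
      obtain ⟨g', hg'⟩ := hψU ⟨ψ g, hψg⟩
      have : ψ g' = ψ g := congrArg Subtype.val hg'
      rw [← hinj this]
      exact g'.2
    rw [hU] at hgU
    induction j with
    | zero => simpa using hℓ 0
    | succ j ihj =>
      have := hgU j
      rw [hg, map_sub, map_sub, map_smul, map_smul, ihj, smul_zero, sub_zero] at this
      rwa [pow_succ, mul_apply_eq_comp]

end Sampling

/-! ### Companion matrices, controllability and observability -/

section Companion

variable {n : ℕ}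

/-- The polynomial `∑ vᵢ s ^ i`. -/
noncomputable def rowPoly (v : Fin n → ℝ) : ℝ[X] :=
  ∑ i : Fin n, C (v i) * X ^ (i : ℕ)

lemma sum_rev_eq_rowPoly (b : Fin n → ℝ) :
    ∑ i : Fin n, C (b i) * X ^ (n - 1 - (i : ℕ)) = rowPoly (systemB b) := by
  rw [rowPoly, ← Equiv.sum_comp Fin.revPerm]
  refine Finset.sum_congr rfl fun i _ => ?_
  simp only [Fin.revPerm_apply, systemB, Fin.val_rev]
  congr 2
  omega

lemma numPoly_eq_rowPoly (b : Fin n → ℝ) : numPoly b = rowPoly (systemB b) :=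
  sum_rev_eq_rowPoly b

lemma monicPoly_eq_add_rowPoly (c : Fin n → ℝ) : monicPoly c = X ^ n + rowPoly (systemB c) := by
  rw [monicPoly, sum_rev_eq_rowPoly]

lemma systemA_eq_transpose (a : Fin n → ℝ) : systemA a = (filterA a)ᵀ := rfl

lemma aeval_transpose (M : Matrix (Fin n) (Fin n) ℝ) (p : ℝ[X]) :
    aeval Mᵀ p = (aeval M p)ᵀ := by
  simp [aeval_eq_sum_range, transpose_sum, transpose_pow]

lemma aeval_mulVec_aeval_mulVec (M : Matrix (Fin n) (Fin n) ℝ) (p q : ℝ[X]) (v : Fin n → ℝ) :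
    aeval M p *ᵥ (aeval M q *ᵥ v) = aeval M (p * q) *ᵥ v := by
  rw [mulVec_mulVec, map_mul]

lemma filterA_mulVec_single (c : Fin n → ℝ) {j k : Fin n} (hjk : (j : ℕ) = k + 1) :
    filterA c *ᵥ Pi.single j 1 = Pi.single k 1 - c (Fin.rev j) • lastVec n := by
  ext i
  simp only [mulVec_single_one, col_apply, filterA, of_apply, Pi.sub_apply, Pi.smul_apply, lastVec,
    Pi.single_apply, Fin.ext_iff, smul_eq_mul]
  have := j.2
  split_ifs <;> first | omega | simp

/-- The pair `(A_r, B_r)` is controllable: `B_r` is a cyclic vector of `A_r`. -/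
lemma exists_aeval_filterA_mulVec_lastVec (c : Fin n → ℝ) (y : Fin n → ℝ) :
    ∃ r : ℝ[X], aeval (filterA c) r *ᵥ lastVec n = y := by
  let S : Submodule ℝ (Fin n → ℝ) := LinearMap.range
    ((mulVecBilin ℝ ℝ).flip (lastVec n) ∘ₗ (aeval (R := ℝ) (filterA c)).toLinearMap)
  have hS : ∀ y, y ∈ S ↔ ∃ r : ℝ[X], aeval (filterA c) r *ᵥ lastVec n = y := fun y => Iff.rfl
  rw [← hS]
  have hlast : lastVec n ∈ S := (hS _).2 ⟨1, by simp⟩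
  have hA : ∀ z ∈ S, filterA c *ᵥ z ∈ S := by
    rintro z ⟨r, rfl⟩
    refine (hS _).2 ⟨X * r, ?_⟩
    rw [← aeval_mulVec_aeval_mulVec, aeval_X]
    rfl
  -- downward induction on the index of the basis vector
  have hsingle : ∀ k : ℕ, ∀ i : Fin n, (i : ℕ) + k + 1 = n → Pi.single i (1 : ℝ) ∈ S := by
    intro k
    induction k with
    | zero =>
      intro i hi
      convert hlast using 1
      ext j
      simp only [Pi.single_apply, lastVec, Fin.ext_iff]
      have := j.2
      split_ifs <;> first | omega | rfl
    | succ k ih =>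
      intro i hi
      have h1 := ih ⟨i + 1, by omega⟩ (by simp; omega)
      have h2 := filterA_mulVec_single c (j := ⟨i + 1, by omega⟩) (k := i) rfl
      have h3 : Pi.single i (1 : ℝ) = filterA c *ᵥ Pi.single ⟨i + 1, by omega⟩ 1
          + c (Fin.rev ⟨i + 1, by omega⟩) • lastVec n := by
        rw [h2, sub_add_cancel]
      rw [h3]
      exact S.add_mem (hA _ h1) (S.smul_mem _ hlast)
  rw [← Finset.univ_sum_single y]
  refine S.sum_mem fun i _ => ?_
  have : Pi.single i (y i) = y i • Pi.single i (1 : ℝ) := by rw [← Pi.single_smul]; simp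
  rw [this]
  exact S.smul_mem _ (hsingle (n - 1 - i) i (by omega))

lemma single_vecMul_filterA (c : Fin n → ℝ) {j k : Fin n} (hjk : (j : ℕ) = k + 1) :
    Pi.single k 1 ᵥ* filterA c = Pi.single j 1 := by
  ext i
  simp only [single_one_vecMul, row_apply, filterA, of_apply, Pi.single_apply, Fin.ext_iff]
  have := j.2
  split_ifs <;> first | omega | rfl

/-- The observability matrix of the pair `(A, C)`, with rows `C A ^ i`. -/
noncomputable def obsMatrix (a : Fin n → ℝ) : Matrix (Fin n) (Fin n) ℝ :=
  Matrix.of fun i => lastVec n ᵥ* systemA a ^ (i : ℕ)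

/-- The observability matrix solves the Sylvester equation of the filter driven by the output, up to
the factor `c(A)` in the forcing term. -/
lemma obsMatrix_mul_systemA (a c : Fin n → ℝ) :
    obsMatrix a * systemA a = filterA c * obsMatrix a +
      vecMulVec (lastVec n) (lastVec n) * aeval (systemA a) (monicPoly c) := by
  have hrow : ∀ i : Fin n, (obsMatrix a * systemA a).row i
      = lastVec n ᵥ* systemA a ^ ((i : ℕ) + 1) := by
    intro i
    rw [pow_succ, ← vecMul_vecMul]
    rfl
  have hc : lastVec n ᵥ* aeval (systemA a) (monicPoly c)
      = lastVec n ᵥ* systemA a ^ n + systemB c ᵥ* obsMatrix a := by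
    have hr : aeval (systemA a) (rowPoly (systemB c))
        = ∑ i : Fin n, systemB c i • systemA a ^ (i : ℕ) := by
      simp [rowPoly, map_sum, Algebra.algebraMap_eq_smul_one]
    rw [monicPoly_eq_add_rowPoly, map_add, vecMul_add, map_pow, aeval_X, hr, vecMul_sum,
      vecMul_eq_sum (systemB c)]
    simp only [vecMul_smul]
    rfl
  ext i j
  have h1 : (obsMatrix a * systemA a) i j = (lastVec n ᵥ* systemA a ^ ((i : ℕ) + 1)) j :=
    congrFun (hrow i) j
  rw [h1, vecMulVec_mul, hc, Matrix.add_apply, vecMulVec_apply]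
  by_cases hi : (i : ℕ) + 1 = n
  · have h2 : (filterA c * obsMatrix a) i j = -(systemB c ᵥ* obsMatrix a) j := by
      simp [Matrix.mul_apply, filterA, hi, vecMul, dotProduct, systemB]
    rw [h2, hi]
    simp [lastVec, hi]
  · have h2 : (filterA c * obsMatrix a) i j = (lastVec n ᵥ* systemA a ^ ((i : ℕ) + 1)) j := by
      rw [Matrix.mul_apply, Finset.sum_eq_single ⟨i + 1, by omega⟩]
      · simp [filterA, hi, obsMatrix]
      · intro k _ hk
        have : (k : ℕ) ≠ i + 1 := fun h => hk (Fin.ext h)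
        simp [filterA, hi, this]
      · simp
    rw [h2]
    simp [lastVec, hi]

variable [NeZero n]

lemma single_zero_vecMul_filterA_pow (c : Fin n → ℝ) (k : Fin n) :
    Pi.single 0 1 ᵥ* filterA c ^ (k : ℕ) = Pi.single k 1 := by
  obtain ⟨k, hk⟩ := k
  induction k with
  | zero => simp
  | succ k ih =>
    have := ih (by omega)
    simp only at this ⊢
    rw [pow_succ, ← vecMul_vecMul, this]
    exact single_vecMul_filterA c rfl

lemma single_zero_vecMul_aeval_rowPoly (c v : Fin n → ℝ) :
    Pi.single 0 1 ᵥ* aeval (filterA c) (rowPoly v) = v := by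
  have : aeval (filterA c) (rowPoly v) = ∑ i : Fin n, v i • filterA c ^ (i : ℕ) := by
    simp [rowPoly, map_sum, Algebra.algebraMap_eq_smul_one]
  rw [this, vecMul_sum]
  simp only [vecMul_smul, single_zero_vecMul_filterA_pow]
  ext j
  simp [Finset.sum_apply, Pi.single_apply]

/-- The first covector of the standard basis is cyclic for `A_r`. -/
lemma aeval_filterA_eq_zero (c : Fin n → ℝ) {q : ℝ[X]}
    (hq : Pi.single 0 1 ᵥ* aeval (filterA c) q = 0) : aeval (filterA c) q = 0 := by
  ext i j
  have : Pi.single i 1 ᵥ* aeval (filterA c) q = 0 := by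
    rw [← single_zero_vecMul_filterA_pow c i, vecMul_vecMul]
    have hcomm : filterA c ^ (i : ℕ) * aeval (filterA c) q
        = aeval (filterA c) q * filterA c ^ (i : ℕ) := by
      have h := congrArg (aeval (filterA c)) (mul_comm (X ^ (i : ℕ)) q)
      simpa using h
    rw [hcomm, ← vecMul_vecMul, hq, zero_vecMul]
  rw [single_one_vecMul] at this
  exact congrFun this j

lemma aeval_filterA_monicPoly (c : Fin n → ℝ) : aeval (filterA c) (monicPoly c) = 0 := by
  apply aeval_filterA_eq_zero
  have hn : 1 ≤ n := NeZero.one_le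
  have hX : Pi.single 0 1 ᵥ* filterA c ^ n = -systemB c := by
    have h1 : filterA c ^ n = filterA c ^ (n - 1) * filterA c := by
      rw [← pow_succ]; congr 1; omega
    have h2 := single_zero_vecMul_filterA_pow c ⟨n - 1, by omega⟩
    simp only at h2
    rw [h1, ← vecMul_vecMul, h2]
    ext j
    simp only [single_one_vecMul, row_apply, filterA, of_apply, systemB, Pi.neg_apply]
    rw [if_pos (by omega)]
  rw [monicPoly_eq_add_rowPoly, map_add, vecMul_add, single_zero_vecMul_aeval_rowPoly, map_pow,
    aeval_X, hX, neg_add_cancel]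

lemma aeval_systemA_monicPoly (a : Fin n → ℝ) : aeval (systemA a) (monicPoly a) = 0 := by
  rw [systemA_eq_transpose, aeval_transpose, aeval_filterA_monicPoly, transpose_zero]

lemma NoCommonRoot.isCoprime {p q : ℝ[X]} (h : NoCommonRoot p q) : IsCoprime p q := by
  rw [isCoprime_iff_aeval_ne_zero_of_isAlgClosed ℝ ℂ]
  intro z
  have := h z
  tauto

/-- The pair `(A, B)` is controllable when the denominator and the numerator of the transfer
function are coprime. -/
lemma exists_aeval_systemA_mulVec_systemB (a b : Fin n → ℝ)
    (hab : NoCommonRoot (monicPoly a) (numPoly b)) (y : Fin n → ℝ) :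
    ∃ r : ℝ[X], aeval (systemA a) r *ᵥ systemB b = y := by
  obtain ⟨w, u, hwu⟩ := hab.isCoprime
  have hrow : ∀ v : Fin n → ℝ, aeval (systemA a) (rowPoly v) *ᵥ Pi.single 0 1 = v := by
    intro v
    rw [systemA_eq_transpose, aeval_transpose, mulVec_transpose, single_zero_vecMul_aeval_rowPoly]
  refine ⟨rowPoly y * u, ?_⟩
  have hu : aeval (systemA a) (u * numPoly b) = 1 := by
    have := congrArg (aeval (systemA a)) hwu
    simpa [aeval_systemA_monicPoly] using this
  conv_lhs => rw [← hrow (systemB b)]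
  rw [aeval_mulVec_aeval_mulVec, ← numPoly_eq_rowPoly, mul_assoc, map_mul, hu, mul_one, hrow]

/-- The observability matrix is invertible; the equation `v ᵥ* O = 0` says that the polynomial with
coefficients `v` annihilates the cyclic vector of the transpose of `A`. -/
lemma eq_zero_of_vecMul_obsMatrix (a : Fin n → ℝ) {v : Fin n → ℝ} (hv : v ᵥ* obsMatrix a = 0) :
    v = 0 := by
  have h1 : aeval (filterA a) (rowPoly v) *ᵥ lastVec n = 0 := by
    rw [← hv]
    have : aeval (filterA a) (rowPoly v) = ∑ i : Fin n, v i • filterA a ^ (i : ℕ) := by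
      simp [rowPoly, map_sum, Algebra.algebraMap_eq_smul_one]
    rw [this, sum_mulVec, vecMul_eq_sum]
    refine Finset.sum_congr rfl fun i _ => ?_
    rw [smul_mulVec]
    congr 1
    change _ = lastVec n ᵥ* systemA a ^ (i : ℕ)
    rw [systemA_eq_transpose, ← transpose_pow, vecMul_transpose]
  have h2 : aeval (filterA a) (rowPoly v) = 0 := by
    refine ext_of_mulVec_single fun i => ?_
    obtain ⟨r, hr⟩ := exists_aeval_filterA_mulVec_lastVec a (Pi.single i 1)
    rw [← hr, aeval_mulVec_aeval_mulVec, mul_comm, ← aeval_mulVec_aeval_mulVec, h1, mulVec_zero,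
      zero_mulVec]
  rw [← single_zero_vecMul_aeval_rowPoly a v, h2, vecMul_zero]

/-- Solution of the Sylvester equation `Π A - A_r Π = B_r C`. -/
lemma exists_sylvester (a c : Fin n → ℝ) (hac : NoCommonRoot (monicPoly a) (monicPoly c)) :
    ∃ P : Matrix (Fin n) (Fin n) ℝ,
      P * systemA a = filterA c * P + vecMulVec (lastVec n) (lastVec n) ∧
      P * aeval (systemA a) (monicPoly c) = obsMatrix a := by
  obtain ⟨w, u, hwu⟩ := hac.isCoprime
  have hu : aeval (systemA a) (monicPoly c * u) = 1 := by
    have := congrArg (aeval (systemA a)) hwu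
    rw [mul_comm]
    simpa [aeval_systemA_monicPoly] using this
  refine ⟨obsMatrix a * aeval (systemA a) u, ?_, ?_⟩
  · have h : aeval (systemA a) u * systemA a = systemA a * aeval (systemA a) u := by
      have h := congrArg (aeval (systemA a)) (mul_comm u X)
      simpa using h
    rw [mul_assoc, h, ← mul_assoc, obsMatrix_mul_systemA a c, add_mul, mul_assoc (vecMulVec _ _),
      ← map_mul, hu, mul_one, mul_assoc]
  · rw [mul_assoc, ← map_mul, mul_comm, hu, mul_one]

/-- The filters, driven by the input and by the output, have independent responses: this is where
the coprimeness assumptions enter. -/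
lemma eq_zero_of_filter_response (a b c : Fin n → ℝ)
    (hab : NoCommonRoot (monicPoly a) (numPoly b)) {P : Matrix (Fin n) (Fin n) ℝ}
    (hP : P * aeval (systemA a) (monicPoly c) = obsMatrix a) {v₁ v₂ : Fin n → ℝ}
    (h : ∀ q : ℝ[X], v₁ ⬝ᵥ (aeval (filterA c) q *ᵥ lastVec n)
      + v₂ ⬝ᵥ (P *ᵥ (aeval (systemA a) q *ᵥ systemB b)
        - aeval (filterA c) q *ᵥ (P *ᵥ systemB b)) = 0) : v₁ = 0 ∧ v₂ = 0 := by
  have h2 : v₂ = 0 := by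
    refine eq_zero_of_vecMul_obsMatrix a (dotProduct_eq_zero _ fun y => ?_)
    obtain ⟨r, rfl⟩ := exists_aeval_systemA_mulVec_systemB a b hab y
    have := h (monicPoly c * r)
    rw [map_mul, map_mul, aeval_filterA_monicPoly, zero_mul, zero_mulVec, dotProduct_zero, zero_add,
      zero_mulVec, sub_zero, ← mulVec_mulVec, mulVec_mulVec, hP, dotProduct_mulVec] at this
    exact this
  refine ⟨dotProduct_eq_zero _ fun y => ?_, h2⟩
  obtain ⟨r, rfl⟩ := exists_aeval_filterA_mulVec_lastVec c y
  simpa [h2] using h r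

end Companion

/-! ### The interconnection as one autonomous system -/

section Composite

open NormedSpace

/-- A square matrix as an operator on column vectors. -/
noncomputable def matCLM {n : ℕ} :
    Matrix (Fin n) (Fin n) ℝ ≃ₐ[ℝ] ((Fin n → ℝ) →L[ℝ] (Fin n → ℝ)) :=
  toLinAlgEquiv'.trans (Module.End.toContinuousLinearMap (Fin n → ℝ))

lemma matCLM_apply {n : ℕ} (A : Matrix (Fin n) (Fin n) ℝ) (v : Fin n → ℝ) :
    matCLM A v = A *ᵥ v := rfl

lemma matCLM_exp {n : ℕ} (A : Matrix (Fin n) (Fin n) ℝ) : matCLM (exp A) = exp (matCLM A) := by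
  let _ : NormedRing (Matrix (Fin n) (Fin n) ℝ) := Matrix.linftyOpNormedRing
  let _ : NormedAlgebra ℝ (Matrix (Fin n) (Fin n) ℝ) := Matrix.linftyOpNormedAlgebra
  let _ : NormedAlgebra ℚ (Matrix (Fin n) (Fin n) ℝ) := .restrictScalars ℚ ℝ _
  exact map_exp (matCLM (n := n))
    (LinearMap.continuous_of_finiteDimensional (matCLM (n := n)).toLinearMap) A

lemma aeval_matCLM {n : ℕ} (A : Matrix (Fin n) (Fin n) ℝ) (p : ℝ[X]) :
    aeval (matCLM A) p = matCLM (aeval A p) :=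
  aeval_algHom_apply (matCLM (n := n)).toAlgHom A p

lemma comp_aeval_of_comp_eq {V W : Type*} [NormedAddCommGroup V] [NormedSpace ℝ V]
    [NormedAddCommGroup W] [NormedSpace ℝ W] {K : V →L[ℝ] W} {M : V →L[ℝ] V} {A : W →L[ℝ] W}
    (h : K ∘L M = A ∘L K) (q : ℝ[X]) : K ∘L aeval M q = aeval A q ∘L K := by
  induction q using Polynomial.induction_on' with
  | add p q hp hq => rw [map_add, map_add, ContinuousLinearMap.comp_add,
      ContinuousLinearMap.add_comp, hp, hq]
  | monomial m r =>
    ext v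
    have := congrArg (fun L : V →L[ℝ] W => L v) (comp_pow_of_comp_eq h m)
    simp only [ContinuousLinearMap.comp_apply] at this
    simp only [aeval_monomial, Algebra.algebraMap_eq_smul_one, smul_mul_assoc, one_mul,
      ContinuousLinearMap.comp_apply, _root_.smul_apply, map_smul, this]

/-- The state `(x, ζ, μ, φ, υ, w)` of the system and its filters, together with the value `w` of the
input, which is constant between two sampling instants. -/
abbrev State (n : ℕ) : Type :=
  (Fin n → ℝ) × (Fin n → ℝ) × (Fin n → ℝ) × (Fin n ⊕ Fin n → ℝ) × ℝ × ℝ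

variable {n : ℕ}

/-- The generator of the interconnection of the system with its filters under a held input. -/
noncomputable def generator (a b c : Fin n → ℝ) (β : ℝ) : State n →L[ℝ] State n :=
  LinearMap.toContinuousLinearMap
    { toFun := fun s =>
        (systemA a *ᵥ s.1 + s.2.2.2.2.2 • systemB b,
          filterA c *ᵥ s.2.1 + s.2.2.2.2.2 • lastVec n,
          filterA c *ᵥ s.2.2.1 + (lastVec n ⬝ᵥ s.1) • lastVec n,
          -β • s.2.2.2.1 + Sum.elim s.2.1 s.2.2.1,
          -β * s.2.2.2.2.1 + s.2.2.2.2.2, 0)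
      map_add' := by
        rintro ⟨x, z, m, f, u, w⟩ ⟨x', z', m', f', u', w'⟩
        simp only [Prod.mk_add_mk, mulVec_add, add_smul, dotProduct_add, smul_add, mul_add,
          Prod.mk.injEq, add_zero, and_true]
        refine ⟨by abel, by abel, by abel, ?_, by ring⟩
        ext (i | i) <;> simp <;> ring
      map_smul' := by
        rintro r ⟨x, z, m, f, u, w⟩
        simp only [Prod.smul_mk, mulVec_smul, dotProduct_smul, smul_add, smul_eq_mul, mul_smul,
          Prod.mk.injEq, mul_zero, and_true, RingHom.id_apply, true_and]
        refine ⟨?_, by ring⟩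
        ext (i | i) <;> simp <;> ring }

lemma generator_apply (a b c : Fin n → ℝ) (β : ℝ) (s : State n) :
    generator a b c β s =
      (systemA a *ᵥ s.1 + s.2.2.2.2.2 • systemB b,
        filterA c *ᵥ s.2.1 + s.2.2.2.2.2 • lastVec n,
        filterA c *ᵥ s.2.2.1 + (lastVec n ⬝ᵥ s.1) • lastVec n,
        -β • s.2.2.2.1 + Sum.elim s.2.1 s.2.2.1,
        -β * s.2.2.2.2.1 + s.2.2.2.2.2, 0) := rfl

/-- The component `x` of the state. -/
noncomputable def prX : State n →L[ℝ] (Fin n → ℝ) := ContinuousLinearMap.fst ℝ _ _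

/-- The component `ζ` of the state. -/
noncomputable def prZ : State n →L[ℝ] (Fin n → ℝ) :=
  ContinuousLinearMap.fst ℝ _ _ ∘L ContinuousLinearMap.snd ℝ _ _

/-- The component `μ` of the state. -/
noncomputable def prM : State n →L[ℝ] (Fin n → ℝ) :=
  ContinuousLinearMap.fst ℝ _ _ ∘L ContinuousLinearMap.snd ℝ _ _ ∘L ContinuousLinearMap.snd ℝ _ _

/-- The component `φ` of the state. -/
noncomputable def prF : State n →L[ℝ] (Fin n ⊕ Fin n → ℝ) :=
  ContinuousLinearMap.fst ℝ _ _ ∘L ContinuousLinearMap.snd ℝ _ _ ∘L ContinuousLinearMap.snd ℝ _ _ ∘L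
    ContinuousLinearMap.snd ℝ _ _

/-- The component `υ` of the state. -/
noncomputable def prU : State n →L[ℝ] ℝ :=
  ContinuousLinearMap.fst ℝ _ _ ∘L ContinuousLinearMap.snd ℝ _ _ ∘L ContinuousLinearMap.snd ℝ _ _ ∘L
    ContinuousLinearMap.snd ℝ _ _ ∘L ContinuousLinearMap.snd ℝ _ _

/-- The held input, as a component of the state. -/
noncomputable def prW : State n →L[ℝ] ℝ :=
  ContinuousLinearMap.snd ℝ _ _ ∘L ContinuousLinearMap.snd ℝ _ _ ∘L ContinuousLinearMap.snd ℝ _ _ ∘L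
    ContinuousLinearMap.snd ℝ _ _ ∘L ContinuousLinearMap.snd ℝ _ _

lemma prX_apply (s : State n) : prX s = s.1 := rfl
lemma prZ_apply (s : State n) : prZ s = s.2.1 := rfl
lemma prM_apply (s : State n) : prM s = s.2.2.1 := rfl
lemma prF_apply (s : State n) : prF s = s.2.2.2.1 := rfl
lemma prU_apply (s : State n) : prU s = s.2.2.2.2.1 := rfl
lemma prW_apply (s : State n) : prW s = s.2.2.2.2.2 := rfl

/-- The generator is block triangular with diagonal blocks `0`, `A`, `A_r`, `A_r`, `-β`, `-β`; hence
a function `f` of it is annihilated by a product of polynomials that annihilate `f` of the blocks.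
The function `f` is given on all operators at once and has to respect intertwining. -/
lemma aeval_generator_eq_zero (a b c : Fin n → ℝ) (β : ℝ)
    (f : ∀ (W : Type) [NormedAddCommGroup W] [NormedSpace ℝ W] [CompleteSpace W],
      (W →L[ℝ] W) → (W →L[ℝ] W))
    (hf : ∀ (W : Type) [NormedAddCommGroup W] [NormedSpace ℝ W] [CompleteSpace W]
      (K : State n →L[ℝ] W) (M : State n →L[ℝ] State n) (A : W →L[ℝ] W),
      K ∘L M = A ∘L K → K ∘L f _ M = f _ A ∘L K)
    {q₀ q₁ q₂ : ℝ[X]} (h₀ : aeval (f ℝ 0) q₀ = 0)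
    (h₁ : aeval (f _ (matCLM (systemA a))) q₁ = 0)
    (h₂ : aeval (f _ (matCLM (filterA c))) q₂ = 0)
    (h₃ : aeval (f ℝ (-β • 1)) q₂ = 0) (h₄ : aeval (f (Fin n ⊕ Fin n → ℝ) (-β • 1)) q₂ = 0) :
    aeval (f _ (generator a b c β)) (q₀ * q₁ * q₂ * q₂) = 0 := by
  set M := generator a b c β with hM
  set Z := f _ M with hZ
  have hcomm : M ∘L Z = Z ∘L M := hf _ M M M rfl
  have hY : ∀ q : ℝ[X], ∀ s, M (aeval Z q s) = aeval Z q (M s) := fun q s =>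
    congrArg (fun L : State n →L[ℝ] State n => L s) (comp_aeval_of_comp_eq hcomm q)
  -- If `L` intertwines `M` and `A` on the range of `p(Z)`, then `L` vanishes on that of `(p q)(Z)`.
  have step : ∀ (W : Type) [NormedAddCommGroup W] [NormedSpace ℝ W] [CompleteSpace W]
      (L : State n →L[ℝ] W) (A : W →L[ℝ] W) (p q : ℝ[X]),
      (∀ s, L (M (aeval Z p s)) = A (L (aeval Z p s))) → aeval (f _ A) q = 0 →
      ∀ s, L (aeval Z (p * q) s) = 0 := by
    intro W _ _ _ L A p q hL hq s
    have h1 : (L ∘L aeval Z p) ∘L M = A ∘L (L ∘L aeval Z p) := by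
      refine ContinuousLinearMap.ext fun s => ?_
      simp only [ContinuousLinearMap.comp_apply, ← hY, hL]
    have h2 := comp_aeval_of_comp_eq (hf _ _ _ _ h1) q
    rw [hq, ContinuousLinearMap.zero_comp] at h2
    rw [map_mul]
    exact congrArg (fun K : State n →L[ℝ] W => K s) h2
  have keep : ∀ (W : Type) [NormedAddCommGroup W] [NormedSpace ℝ W]
      (L : State n →L[ℝ] W) (p q : ℝ[X]), (∀ s, L (aeval Z p s) = 0) →
      ∀ s, L (aeval Z (p * q) s) = 0 := by
    intro W _ _ L p q hL s
    rw [map_mul]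
    exact hL _
  have hw0 : ∀ s, prW (aeval Z q₀ s) = 0 := by
    have := step ℝ prW 0 1 q₀ (fun s => rfl) h₀
    simpa using this
  have hw1 := keep _ prW q₀ q₁ hw0
  have hx1 : ∀ s, prX (aeval Z (q₀ * q₁) s) = 0 := by
    refine step _ prX (matCLM (systemA a)) q₀ q₁ (fun s => ?_) h₁
    have hw := hw0 s
    rw [prW_apply] at hw
    simp [-map_mul, hM, prX_apply, generator_apply, matCLM_apply, hw]
  have hw2 := keep _ prW _ q₂ hw1
  have hx2 := keep _ prX _ q₂ hx1
  have hz2 : ∀ s, prZ (aeval Z (q₀ * q₁ * q₂) s) = 0 := by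
    refine step _ prZ (matCLM (filterA c)) _ q₂ (fun s => ?_) h₂
    have hw := hw1 s
    rw [prW_apply] at hw
    simp [-map_mul, hM, prZ_apply, generator_apply, matCLM_apply, hw]
  have hm2 : ∀ s, prM (aeval Z (q₀ * q₁ * q₂) s) = 0 := by
    refine step _ prM (matCLM (filterA c)) _ q₂ (fun s => ?_) h₂
    have hx := hx1 s
    rw [prX_apply] at hx
    simp [-map_mul, hM, prM_apply, generator_apply, matCLM_apply, hx]
  have hu2 : ∀ s, prU (aeval Z (q₀ * q₁ * q₂) s) = 0 := by
    refine step _ prU (-β • 1) _ q₂ (fun s => ?_) h₃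
    have hw := hw1 s
    rw [prW_apply] at hw
    simp [-map_mul, hM, prU_apply, generator_apply, hw]
  have hf3 : ∀ s, prF (aeval Z (q₀ * q₁ * q₂ * q₂) s) = 0 := by
    refine step _ prF (-β • 1) _ q₂ (fun s => ?_) h₄
    have hz := hz2 s
    have hm := hm2 s
    rw [prZ_apply] at hz
    rw [prM_apply] at hm
    simp [-map_mul, hM, prF_apply, generator_apply, hz, hm]
  refine ContinuousLinearMap.ext fun s => ?_
  exact Prod.ext (keep _ prX _ q₂ hx2 s) (Prod.ext (keep _ prZ _ q₂ hz2 s)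
    (Prod.ext (keep _ prM _ q₂ hm2 s) (Prod.ext (hf3 s)
    (Prod.ext (keep _ prU _ q₂ hu2 s) (keep _ prW _ q₂ hw2 s)))))

lemma aeval_smul_one_eq_zero {W : Type*} [NormedAddCommGroup W] [NormedSpace ℝ W] {r : ℝ} {p : ℝ[X]}
    (hp : p.eval r = 0) : aeval (r • (1 : W →L[ℝ] W)) p = 0 := by
  rw [← Algebra.algebraMap_eq_smul_one, aeval_algebraMap_apply, coe_aeval_eq_eval, hp, map_zero]

lemma exp_smul_smul_one {W : Type*} [NormedAddCommGroup W] [NormedSpace ℝ W] [CompleteSpace W]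
    (T r : ℝ) : exp (T • r • (1 : W →L[ℝ] W)) = Real.exp (r * T) • (1 : W →L[ℝ] W) := by
  rw [smul_smul, ← Algebra.algebraMap_eq_smul_one, ← Algebra.algebraMap_eq_smul_one,
    ← algebraMap_exp_comm, Real.exp_eq_exp_ℝ, mul_comm]

/-- A real polynomial annihilating the generator, all of whose roots are modes or zero. -/
lemma aeval_generator_charpoly (a b c : Fin n → ℝ) (β : ℝ) :
    aeval (generator a b c β) (X * (systemA a).charpoly * ((filterA c).charpoly * (X + C β)) *
      ((filterA c).charpoly * (X + C β))) = 0 := by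
  refine aeval_generator_eq_zero a b c β (fun W _ _ _ K => K) (fun W _ _ _ K M A h => h)
    (by simp) ?_ ?_ ?_ ?_
  · rw [aeval_matCLM, aeval_self_charpoly, map_zero]
  · rw [map_mul, aeval_matCLM, aeval_self_charpoly, map_zero, zero_mul]
  · exact aeval_smul_one_eq_zero (by simp)
  · exact aeval_smul_one_eq_zero (by simp)

lemma aeval_exp_filterA_firPoly (c : Fin n → ℝ) (β T : ℝ) :
    aeval (exp (T • filterA c)) (firPoly c β T) = 0 := by
  rw [firPoly, ← transpose_smul, exp_transpose, charpoly_transpose, map_mul, aeval_self_charpoly,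
    mul_zero]

lemma eval_firPoly (c : Fin n → ℝ) (β T : ℝ) : (firPoly c β T).eval (Real.exp (-β * T)) = 0 := by
  simp [firPoly]

/-- A real polynomial annihilating the sampled generator, which is a multiple of the polynomial of
the finite impulse response filter. -/
lemma aeval_exp_generator (a b c : Fin n → ℝ) (β T : ℝ) :
    aeval (exp (T • generator a b c β)) ((X - C 1) * (exp (T • systemA a)).charpoly *
      firPoly c β T * firPoly c β T) = 0 := by
  refine aeval_generator_eq_zero a b c β (fun W _ _ _ K => exp (T • K)) ?_ ?_ ?_ ?_ ?_ ?_
  · intro W _ _ _ K M A h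
    refine comp_exp_of_comp_eq ?_
    rw [ContinuousLinearMap.comp_smul, h, ContinuousLinearMap.smul_comp]
  · simp
  · rw [← map_smul, ← matCLM_exp, aeval_matCLM, aeval_self_charpoly, map_zero]
  · rw [← map_smul, ← matCLM_exp, aeval_matCLM, aeval_exp_filterA_firPoly, map_zero]
  · rw [exp_smul_smul_one]
    exact aeval_smul_one_eq_zero (eval_firPoly c β T)
  · rw [exp_smul_smul_one]
    exact aeval_smul_one_eq_zero (eval_firPoly c β T)

/-- A unit held input. -/
def inputVec (n : ℕ) : State n := (0, 0, 0, 0, 0, 1)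

lemma SolvesOn.mono {E : Type*} [NormedAddCommGroup E] [NormedSpace ℝ E] {τ : ℝ} {z f : ℝ → E}
    (h : SolvesOn τ z f) {r s : ℝ} (hr : 0 ≤ r) (hs : s ≤ τ) :
    ContinuousOn z (Icc r s) ∧ ∀ t ∈ Ico r s, HasDerivWithinAt z (f t) (Ici t) t :=
  ⟨h.1.mono (Icc_subset_Icc hr hs), fun t ht => h.2 t ⟨hr.trans ht.1, ht.2.trans_le hs⟩⟩

/-- Exact discretization: under a held input, one sampling period acts as `exp (T M)` on the state
augmented with the value of the input. -/
lemma IsTrajectory.sample_succ {a b c : Fin n → ℝ} {β τ : ℝ} {x₀ : Fin n → ℝ} {u : ℝ → ℝ}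
    {x ζ μ : ℝ → Fin n → ℝ} {φ : ℝ → Fin n ⊕ Fin n → ℝ} {υ : ℝ → ℝ}
    (h : IsTrajectory a b c β τ x₀ u x ζ μ φ υ) {r T w : ℝ} (hr : 0 ≤ r) (hT : 0 < T)
    (hτ : r + T ≤ τ) (hu : ∀ t ∈ Ico r (r + T), u t = w) :
    ((x (r + T), ζ (r + T), μ (r + T), φ (r + T), υ (r + T), w) : State n) =
      exp (T • generator a b c β) (x r, ζ r, μ r, φ r, υ r, w) := by
  have : CompleteSpace (State n →L[ℝ] State n) := FiniteDimensional.complete ℝ _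
  set M := generator a b c β with hM
  set s : ℝ → State n := fun t => (x t, ζ t, μ t, φ t, υ t, w) with hs
  have hx := h.x_ode.mono hr hτ
  have hζ := h.ζ_ode.mono hr hτ
  have hμ := h.μ_ode.mono hr hτ
  have hφ := h.φ_ode.mono hr hτ
  have hυ := h.υ_ode.mono hr hτ
  have hcont : ContinuousOn s (Icc r (r + T)) :=
    hx.1.prodMk (hζ.1.prodMk (hμ.1.prodMk (hφ.1.prodMk (hυ.1.prodMk continuousOn_const))))
  have hderiv : ∀ t ∈ Ico r (r + T), HasDerivWithinAt s (M (s t)) (Ici t) t := by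
    intro t ht
    have h1 := (hx.2 t ht).prodMk ((hζ.2 t ht).prodMk ((hμ.2 t ht).prodMk ((hφ.2 t ht).prodMk
      ((hυ.2 t ht).prodMk (hasDerivWithinAt_const t (Ici t) w)))))
    rw [hu t ht] at h1
    exact h1
  have hderiv' : ∀ t : ℝ, HasDerivAt (fun t => exp ((t - r) • M) (s r))
      (M (exp ((t - r) • M) (s r))) t := by
    intro t
    have h1 : HasDerivAt (fun t : ℝ => exp ((t - r) • M)) (M * exp ((t - r) • M)) t := by
      have := (hasDerivAt_exp_smul_const' M (t - r)).scomp t ((hasDerivAt_id t).sub_const r)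
      rw [one_smul] at this
      exact this
    have h2 := h1.clm_apply (hasDerivAt_const t (s r))
    simpa using h2
  have huniq := ODE_solution_unique_of_mem_Icc_right (v := fun _ => M) (s := fun _ => univ)
    (K := ‖M‖₊) (f := s) (g := fun t => exp ((t - r) • M) (s r)) (a := r) (b := r + T)
    (fun t _ => M.lipschitz.lipschitzOnWith) hcont hderiv (fun _ _ => mem_univ _)
    (fun t _ => (hderiv' t).continuousAt.continuousWithinAt)
    (fun t _ => (hderiv' t).hasDerivWithinAt) (fun _ _ => mem_univ _) (by simp)
  have := huniq (right_mem_Icc.2 (by linarith : r ≤ r + T))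
  simpa using this

end Composite

/-! ### Nonpathological sampling of real systems -/

section RealSampling

open NormedSpace

variable {V : Type*} [NormedAddCommGroup V] [NormedSpace ℝ V] [FiniteDimensional ℝ V]

/-- The space of complex-valued real-linear functionals on `V`, as a complex vector space. It serves
as the complexification of the dual of `V`. -/
def ComplexDual (V : Type*) [NormedAddCommGroup V] [NormedSpace ℝ V] : Type _ := V →L[ℝ] ℂ

noncomputable instance : NormedAddCommGroup (ComplexDual V) :=
  inferInstanceAs (NormedAddCommGroup (V →L[ℝ] ℂ))

noncomputable instance : NormedSpace ℂ (ComplexDual V) :=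
  inferInstanceAs (NormedSpace ℂ (V →L[ℝ] ℂ))

instance : FiniteDimensional ℂ (ComplexDual V) :=
  FiniteDimensional.right ℝ ℂ (V →L[ℝ] ℂ)

/-- Evaluation of functionals at `v`. -/
noncomputable def evalCLM (v : V) : ComplexDual V →L[ℂ] ℂ :=
  LinearMap.toContinuousLinearMap
    { toFun := fun h => (show V →L[ℝ] ℂ from h) v
      map_add' := fun _ _ => rfl
      map_smul' := fun _ _ => rfl }

lemma ComplexDual.ext {g h : ComplexDual V} (H : ∀ v, evalCLM v g = evalCLM v h) : g = h :=
  ContinuousLinearMap.ext (f := (show V →L[ℝ] ℂ from g)) (g := (show V →L[ℝ] ℂ from h)) H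

/-- The operator on functionals induced by `M`: the complexification of the transpose of `M`. -/
noncomputable def precompCLM (M : V →L[ℝ] V) : ComplexDual V →L[ℂ] ComplexDual V :=
  LinearMap.toContinuousLinearMap
    { toFun := fun h => (show V →L[ℝ] ℂ from h) ∘L M
      map_add' := fun _ _ => rfl
      map_smul' := fun _ _ => rfl }

lemma evalCLM_precompCLM (M : V →L[ℝ] V) (h : ComplexDual V) (v : V) :
    evalCLM v (precompCLM M h) = evalCLM (M v) h := rfl

lemma evalCLM_add (v w : V) (h : ComplexDual V) :
    evalCLM (v + w) h = evalCLM v h + evalCLM w h :=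
  map_add (show V →L[ℝ] ℂ from h) v w

lemma evalCLM_smul (r : ℝ) (v : V) (h : ComplexDual V) :
    evalCLM (r • v) h = (r : ℂ) * evalCLM v h :=
  map_smul (show V →L[ℝ] ℂ from h) r v

lemma evalCLM_precompCLM_pow (M : V →L[ℝ] V) (k : ℕ) (h : ComplexDual V) (v : V) :
    evalCLM v ((precompCLM M ^ k) h) = evalCLM ((M ^ k) v) h := by
  induction k generalizing h with
  | zero => rfl
  | succ k ih =>
    rw [pow_succ, mul_apply_eq_comp, ih, evalCLM_precompCLM, pow_succ']
    rfl

lemma exp_precompCLM (M : V →L[ℝ] V) : exp (precompCLM M) = precompCLM (exp M) := by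
  have : CompleteSpace V := FiniteDimensional.complete ℝ V
  have : CompleteSpace (ComplexDual V) := FiniteDimensional.complete ℂ _
  refine ContinuousLinearMap.ext fun h => ComplexDual.ext fun v => ?_
  have h1 := ((exp_series_hasSum_exp' (𝕂 := ℂ) (precompCLM M)).mapL
    (ContinuousLinearMap.apply ℂ (ComplexDual V) h)).mapL (evalCLM v)
  have h2 := ((exp_series_hasSum_exp' (𝕂 := ℝ) M).mapL (ContinuousLinearMap.apply ℝ V v)).mapL
    (show V →L[ℝ] ℂ from h)
  refine h1.unique (h2.congr_fun fun k => ?_)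
  have h3 := evalCLM_precompCLM_pow M k h v
  have h4 := evalCLM_smul ((k.factorial : ℝ)⁻¹) ((M ^ k) v) h
  rw [map_smul, map_smul, ContinuousLinearMap.apply_apply, h3, smul_eq_mul]
  refine Eq.trans ?_ h4.symm
  push_cast
  rfl

lemma evalCLM_aeval_precompCLM (M : V →L[ℝ] V) (P : ℝ[X]) (h : ComplexDual V) (v : V) :
    evalCLM v (aeval (precompCLM M) (P.map (algebraMap ℝ ℂ)) h) = evalCLM (aeval M P v) h := by
  induction P using Polynomial.induction_on' with
  | add p q hp hq =>
    rw [Polynomial.map_add, map_add, map_add, _root_.add_apply, _root_.add_apply, map_add,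
      evalCLM_add, hp, hq]
  | monomial m r =>
    rw [map_monomial, aeval_monomial, aeval_monomial, mul_apply_eq_comp, mul_apply_eq_comp,
      ContinuousLinearMap.algebraMap_apply, ContinuousLinearMap.algebraMap_apply, map_smul,
      evalCLM_precompCLM_pow, evalCLM_smul]
    rfl

lemma aeval_apply_of_eigenvector {E : Type*} [NormedAddCommGroup E] [NormedSpace ℂ E]
    {K : E →L[ℂ] E} {κ : ℂ} {v : E} (h : K v = κ • v) (P : ℂ[X]) :
    aeval K P v = P.eval κ • v := by
  induction P using Polynomial.induction_on' with
  | add p q hp hq => simp [hp, hq, add_smul]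
  | monomial m r =>
    rw [aeval_monomial, mul_apply_eq_comp, pow_apply_of_eigenvector h, ContinuousLinearMap.algebraMap_apply,
      eval_monomial, mul_smul]

/-- Nonpathological sampling preserves observability, for real operators: the spectrum is controlled
by the complex roots of an annihilating polynomial. -/
theorem apply_pow_eq_zero_of_sampled_real {M : V →L[ℝ] V} {T : ℝ} (hT : T ≠ 0) {P : ℝ[X]}
    (hP0 : P ≠ 0) (hP : aeval M P = 0)
    (hS : ∀ l κ : ℂ, aeval l P = 0 → aeval κ P = 0 →
      Complex.exp (T * κ) = Complex.exp (T * l) → κ = l)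
    (H : V →L[ℝ] ℝ) (e : V) (hH : ∀ k : ℕ, H ((exp (T • M) ^ k) e) = 0) (j : ℕ) :
    H ((M ^ j) e) = 0 := by
  set Q : ℂ[X] := P.map (algebraMap ℝ ℂ) with hQ
  have hQ0 : Q ≠ 0 := (Polynomial.map_ne_zero_iff (algebraMap ℝ ℂ).injective).2 hP0
  have hQP : ∀ z : ℂ, Q.eval z = aeval z P := fun z => by rw [hQ, eval_map_algebraMap]
  let h : ComplexDual V := Complex.ofRealCLM ∘L H
  have hzero : ∀ g : ComplexDual V, aeval (precompCLM M) Q g = 0 := by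
    intro g
    refine ComplexDual.ext fun v => ?_
    rw [evalCLM_aeval_precompCLM, hP, map_zero]
    exact map_zero (show V →L[ℝ] ℂ from g)
  have key := apply_pow_eq_zero_of_sampled (K := precompCLM M) (T := (T : ℂ))
    (by exact_mod_cast hT) (S := {z | aeval z P = 0}) (fun l hl κ hκ => hS l κ hl hκ)
    (fun κ v hv hKv => by
      have h1 := aeval_apply_of_eigenvector hKv Q
      rw [hzero, hQP] at h1
      exact (smul_eq_zero.1 h1.symm).resolve_right hv)
    (evalCLM e) Q.roots (fun l hl => by
      have := (mem_roots hQ0).1 hl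
      rwa [IsRoot, hQP] at this) h
    (by
      have h1 := (IsAlgClosed.splits Q).eq_prod_roots
      have h2 := hzero h
      rw [h1, map_mul, aeval_C, Algebra.algebraMap_eq_smul_one, smul_mul_assoc, one_mul] at h2
      exact (smul_eq_zero.1 h2).resolve_left (leadingCoeff_ne_zero.2 hQ0))
    (fun k => by
      have h1 : (T : ℂ) • precompCLM M = precompCLM (T • M) := by
        refine ContinuousLinearMap.ext fun g => ComplexDual.ext fun v => ?_
        rw [evalCLM_precompCLM, _root_.smul_apply, _root_.smul_apply, map_smul, evalCLM_precompCLM,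
          evalCLM_smul, smul_eq_mul]
      rw [h1, exp_precompCLM, evalCLM_precompCLM_pow]
      change ((H ((exp (T • M) ^ k) e) : ℝ) : ℂ) = 0
      rw [hH, Complex.ofReal_zero]) j
  rw [evalCLM_precompCLM_pow] at key
  exact_mod_cast (show ((H ((M ^ j) e) : ℝ) : ℂ) = 0 from key)

end RealSampling

/-! ### The modes and the sampling time -/

section Modes

variable {n : ℕ}

lemma mem_complexSpectrum_iff (M : Matrix (Fin n) (Fin n) ℝ) (z : ℂ) :
    z ∈ complexSpectrum M ↔ aeval z M.charpoly = 0 := by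
  have h : M.map (fun r : ℝ => (r : ℂ)) = (algebraMap ℝ ℂ).mapMatrix M := rfl
  rw [complexSpectrum, mem_spectrum_iff_isRoot_charpoly, h, RingHom.mapMatrix_apply,
    charpoly_map, IsRoot, eval_map_algebraMap]

lemma conj_mem_complexSpectrum {M : Matrix (Fin n) (Fin n) ℝ} {z : ℂ} (hz : z ∈ complexSpectrum M) :
    (starRingEnd ℂ) z ∈ complexSpectrum M := by
  rw [mem_complexSpectrum_iff] at hz ⊢
  rw [aeval_conj, hz, map_zero]

lemma conj_mem_modes {a c : Fin n → ℝ} {β : ℝ} {z : ℂ} (hz : z ∈ modes a c β) :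
    (starRingEnd ℂ) z ∈ modes a c β := by
  rcases hz with (hz | hz) | hz
  · left; left
    rw [mem_singleton_iff] at hz ⊢
    simp [hz]
  · exact Or.inl (Or.inr (conj_mem_complexSpectrum hz))
  · exact Or.inr (conj_mem_complexSpectrum hz)

/-- Under nonpathological sampling the exponential separates the modes from each other and from `0`.
The value `0` may be added because the set of modes is stable under conjugation: a mode
`2 π i h / T` would differ from its conjugate by `2 π i (2 h) / T`. -/
lemma NonPathological.exp_injOn {a c : Fin n → ℝ} {β T : ℝ} (hT : 0 < T)
    (h : NonPathological (modes a c β) T) {l κ : ℂ} (hl : l ∈ modes a c β ∨ l = 0)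
    (hκ : κ ∈ modes a c β ∨ κ = 0) (he : Complex.exp (T * κ) = Complex.exp (T * l)) : κ = l := by
  have hTC : (T : ℂ) ≠ 0 := by exact_mod_cast hT.ne'
  obtain ⟨m, hm⟩ := Complex.exp_eq_exp_iff_exists_int.1 he
  have hκl : κ = l + Complex.I * (2 * (m : ℂ) * (Real.pi : ℂ)) * (T : ℂ)⁻¹ := by
    have h1 : κ = (T * κ) * (T : ℂ)⁻¹ := by field_simp
    rw [h1, hm]
    field_simp
  by_cases hm0 : m = 0
  · rw [hκl, hm0]; simp
  exfalso
  -- a nonzero multiple of `2 π i / T` is not a mode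
  have hzero : ∀ k : ℤ, k ≠ 0 → Complex.I * (2 * (k : ℂ) * (Real.pi : ℂ)) * (T : ℂ)⁻¹ ∉
      modes a c β := by
    intro k hk hmem
    refine h ⟨_, conj_mem_modes hmem, 2 * k, by omega, ?_⟩
    convert hmem using 1
    simp only [map_mul, Complex.conj_I, map_inv₀, Complex.conj_ofReal, map_ofNat, map_intCast,
      Int.cast_mul, Int.cast_ofNat]
    ring
  rcases hl with hl | rfl
  · rcases hκ with hκ | rfl
    · exact h ⟨l, hl, m, hm0, hκl ▸ hκ⟩
    · refine hzero (-m) (by omega) ?_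
      convert hl using 1
      push_cast
      linear_combination hκl
  · rcases hκ with hκ | rfl
    · refine hzero m hm0 ?_
      rwa [hκl, zero_add] at hκ
    · rw [zero_add, eq_comm] at hκl
      simp [hm0, hTC, Real.pi_ne_zero] at hκl

end Modes

/-! ### Persistency of excitation and Markov parameters -/

section Excitation

lemma PersistentlyExciting.eq_zero {L M : ℕ} {s : ℕ → ℝ} (h : PersistentlyExciting L M s)
    {g : Fin L → ℝ} (hg : ∀ j : ℕ, j < M + 1 - L → ∑ i : Fin L, g i * s (i + j + 1) = 0) :
    g = 0 := by
  have hli : LinearIndependent ℝ (hankelMatrix L M s).row := by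
    rw [linearIndependent_iff_card_eq_finrank_span, Fintype.card_fin, Set.finrank,
      ← rank_eq_finrank_span_row]
    exact h.symm
  refine vecMul_injective_iff.2 hli ?_
  simp only [zero_vecMul]
  ext j
  exact hg j j.2

variable {V : Type*} [NormedAddCommGroup V] [NormedSpace ℝ V]

lemma state_add {F : V →L[ℝ] V} {G : V} {ξ : ℕ → V} {d : ℕ → ℝ} {N : ℕ}
    (hξ : ∀ k < N, ξ (k + 1) = F (ξ k) + d k • G) (k m : ℕ) (hkm : k + m ≤ N) :
    ξ (k + m) = (F ^ m) (ξ k) + ∑ i ∈ Finset.range m, d (k + i) • (F ^ (m - 1 - i)) G := by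
  induction m with
  | zero => simp
  | succ m ih =>
    rw [← add_assoc, hξ _ (by omega), ih (by omega), Finset.sum_range_succ, map_add, map_sum,
      pow_succ' F m, mul_apply_eq_comp, add_assoc]
    congr 2
    · refine Finset.sum_congr rfl fun i hi => ?_
      have hi' := Finset.mem_range.1 hi
      rw [map_smul, ← mul_apply_eq_comp, ← pow_succ']
      congr 3
      omega
    · simp

lemma apply_aeval (F : V →L[ℝ] V) (H : V →L[ℝ] ℝ) (P : ℝ[X]) (v : V) :
    H (aeval F P v) = ∑ m ∈ Finset.range (P.natDegree + 1), P.coeff m * H ((F ^ m) v) := by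
  have : aeval F P v = ∑ m ∈ Finset.range (P.natDegree + 1), P.coeff m • ((F ^ m) v) := by
    rw [aeval_eq_sum_range]
    exact map_sum (ContinuousLinearMap.apply ℝ V v) _ _
  rw [this, map_sum]
  simp

/-- If the output `H ξ` of a sampled system satisfies the recurrence given by a monic annihilating
polynomial `P` of the state matrix, then the recurrence is one for the input alone; persistency of
excitation forces its coefficients, hence the Markov parameters, to vanish. -/
lemma markov_eq_zero {F : V →L[ℝ] V} {G : V} (H : V →L[ℝ] ℝ) {ξ : ℕ → V} {d : ℕ → ℝ} {N L : ℕ}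
    (hN : 1 ≤ N) (hξ : ∀ k < N, ξ (k + 1) = F (ξ k) + d k • G) {P : ℝ[X]} (hPm : P.Monic)
    (hP : aeval F P = 0) (hPL : P.natDegree ≤ L)
    (hrec : ∀ k, 1 ≤ k → k + P.natDegree ≤ N →
      ∑ m ∈ Finset.range (P.natDegree + 1), P.coeff m * H (ξ (k + m)) = 0)
    (hd : PersistentlyExciting L (N - 1) d) (j : ℕ) : H ((F ^ j) G) = 0 := by
  set D := P.natDegree with hD
  set q : ℕ → ℝ := fun i => ∑ m ∈ Finset.range (D + 1),
    if i < m then P.coeff m * H ((F ^ (m - 1 - i)) G) else 0 with hq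
  have hq0 : ∀ i < L, q i = 0 := by
    have h1 : (fun i : Fin L => q i) = 0 := by
      refine hd.eq_zero fun j hj => ?_
      have h2 := hrec (j + 1) (by omega) (by omega)
      have h3 : ∀ m ∈ Finset.range (D + 1), P.coeff m * H (ξ (j + 1 + m))
          = P.coeff m * H ((F ^ m) (ξ (j + 1))) + ∑ i ∈ Finset.range L,
            (if i < m then P.coeff m * H ((F ^ (m - 1 - i)) G) else 0) * d (i + j + 1) := by
        intro m hm
        have hm' := Finset.mem_range.1 hm
        rw [state_add hξ (j + 1) m (by omega), map_add, mul_add, map_sum, Finset.mul_sum]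
        congr 1
        have hsub : Finset.range m ⊆ Finset.range L := Finset.range_subset_range.2 (by omega)
        rw [← Finset.sum_subset hsub]
        · refine Finset.sum_congr rfl fun i hi => ?_
          rw [if_pos (Finset.mem_range.1 hi), map_smul, smul_eq_mul,
            show j + 1 + i = i + j + 1 by omega]
          ring
        · intro i _ hi
          rw [if_neg (by simpa using hi), zero_mul]
      rw [Finset.sum_congr rfl h3, Finset.sum_add_distrib, ← apply_aeval, hP, _root_.zero_apply, map_zero,
        zero_add, Finset.sum_comm] at h2
      rw [Fin.sum_univ_eq_sum_range (fun i => q i * d (i + j + 1)), ← h2]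
      simp only [hq, Finset.sum_mul]
    intro i hi
    exact congrFun h1 ⟨i, hi⟩
  -- Both the vanishing of `q` (for `j < D`) and `P(F) = 0` (for `D ≤ j`) express the `j`-th Markov
  -- parameter through the earlier ones, as `P` is monic.
  induction j using Nat.strong_induction_on with
  | _ j ih =>
    rcases lt_or_ge j D with hj | hj
    · have h1 := hq0 (D - 1 - j) (by omega)
      simp only [hq] at h1
      rw [Finset.sum_range_succ, Finset.sum_eq_zero, zero_add, if_pos (by omega), hD,
        hPm.coeff_natDegree, one_mul, ← hD, show D - 1 - (D - 1 - j) = j by omega] at h1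
      · exact h1
      · intro m hm
        have hm' := Finset.mem_range.1 hm
        split_ifs with h
        · rw [ih _ (by omega), mul_zero]
        · rfl
    · have h1 := apply_aeval F H P ((F ^ (j - D)) G)
      rw [hP, _root_.zero_apply, map_zero, Finset.sum_range_succ, Finset.sum_eq_zero, zero_add,
        hPm.coeff_natDegree, one_mul, ← mul_apply_eq_comp, ← pow_add, ← hD,
        show D + (j - D) = j by omega] at h1
      · exact h1.symm
      · intro m hm
        have hm' := Finset.mem_range.1 hm
        rw [← mul_apply_eq_comp, ← pow_add, ih _ (by omega), mul_zero]

/-- A sequence that satisfies the recurrence of `p` satisfies that of every multiple of `p`. -/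
lemma recurrence_mul {p q : ℝ[X]} (hp : p.Monic) (hq : q.Monic) {s : ℕ → ℝ} {N : ℕ}
    (h : ∀ k, 1 ≤ k → k + p.natDegree ≤ N →
      ∑ m ∈ Finset.range (p.natDegree + 1), p.coeff m * s (k + m) = 0)
    (k : ℕ) (hk : 1 ≤ k) (hkN : k + (q * p).natDegree ≤ N) :
    ∑ m ∈ Finset.range ((q * p).natDegree + 1), (q * p).coeff m * s (k + m) = 0 := by
  let σ : Module.End ℝ (ℕ → ℝ) := LinearMap.funLeft ℝ ℝ Nat.succ
  have hσ : ∀ (m : ℕ) (r : ℕ → ℝ) (k : ℕ), (σ ^ m) r k = r (k + m) := by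
    intro m
    induction m with
    | zero => intro r k; rfl
    | succ m ih =>
      intro r k
      rw [pow_succ, Module.End.mul_apply, ih]
      rfl
  have haeval : ∀ (P : ℝ[X]) (r : ℕ → ℝ) (k : ℕ), aeval σ P r k
      = ∑ m ∈ Finset.range (P.natDegree + 1), P.coeff m * r (k + m) := by
    intro P r k
    rw [aeval_eq_sum_range, LinearMap.sum_apply, Finset.sum_apply]
    refine Finset.sum_congr rfl fun m _ => ?_
    rw [LinearMap.smul_apply, Pi.smul_apply, hσ, smul_eq_mul]
  rw [← haeval, map_mul, Module.End.mul_apply, haeval]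
  rw [hq.natDegree_mul hp] at hkN
  refine Finset.sum_eq_zero fun m hm => ?_
  have hm' := Finset.mem_range.1 hm
  rw [haeval, h (k + m) (by omega) (by omega), mul_zero]

end Excitation

/-! ### The finite impulse response filter and the disturbance -/

section Filter

open NormedSpace

variable {n : ℕ}

lemma firPoly_monic (c : Fin n → ℝ) (β T : ℝ) : (firPoly c β T).Monic :=
  (monic_X_sub_C _).mul (charpoly_monic _)

lemma firPoly_natDegree (c : Fin n → ℝ) (β T : ℝ) : (firPoly c β T).natDegree = n + 1 := by
  rw [firPoly, (monic_X_sub_C _).natDegree_mul (charpoly_monic _), natDegree_X_sub_C,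
    charpoly_natDegree_eq_dim, Fintype.card_fin, add_comm]

/-- Multiplication by the Toeplitz matrix applies the polynomial of the filter to the shift. -/
lemma sum_mul_firMatrix (c : Fin n → ℝ) (β T : ℝ) {N : ℕ} (g : ℕ → ℝ) (j : Fin (N - n - 1)) :
    ∑ k : Fin N, g k * firMatrix c β T N k j
      = ∑ m ∈ Finset.range (n + 2), (firPoly c β T).coeff m * g (j + m) := by
  have hj := j.2
  have h1 : ∀ k : Fin N, g k * firMatrix c β T N k j = (fun k : ℕ => if (j : ℕ) ≤ k ∧ k - j ≤ n + 1
      then (firPoly c β T).coeff (k - j) * g k else 0) k := by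
    intro k
    simp only [firMatrix, of_apply, firCoeff]
    split_ifs with h
    · rw [show n + 1 - (n + 1 - ((k : ℕ) - j)) = k - j by omega, mul_comm]
    · rw [mul_zero]
  rw [Finset.sum_congr rfl fun k _ => h1 k, Fin.sum_univ_eq_sum_range
    (fun k : ℕ => if (j : ℕ) ≤ k ∧ k - j ≤ n + 1 then (firPoly c β T).coeff (k - j) * g k else 0)]
  have hsub : Finset.Ico (j : ℕ) (j + (n + 2)) ⊆ Finset.range N := by
    intro k hk
    rw [Finset.mem_Ico] at hk
    rw [Finset.mem_range]
    omega
  rw [← Finset.sum_subset hsub, Finset.sum_Ico_eq_sum_range]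
  · refine Finset.sum_congr (by congr 1; omega) fun m hm => ?_
    have hm' := Finset.mem_range.1 hm
    rw [if_pos (by omega), Nat.add_sub_cancel_left]
  · intro k _ hk
    rw [Finset.mem_Ico] at hk
    rw [if_neg (by omega)]

lemma sampleMatrix_mul_firMatrix_apply {ι : Type*} (c : Fin n → ℝ) (β T : ℝ) (N : ℕ)
    (f : ℝ → ι → ℝ) (i : ι) (j : Fin (N - n - 1)) :
    (sampleMatrix N T f * firMatrix c β T N) i j
      = ∑ m ∈ Finset.range (n + 2), (firPoly c β T).coeff m *
        f ((((j + m : ℕ) : ℝ) + 1) * T) i :=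
  sum_mul_firMatrix c β T (fun k : ℕ => f (((k : ℝ) + 1) * T) i) j

/-- The polynomial of the filter annihilates both exponentials in the disturbance. -/
lemma sampleMatrix_epsSignal_mul_firMatrix (c : Fin n → ℝ) (β T : ℝ) (N : ℕ)
    (Γ : Matrix (Fin n ⊕ Fin n) (Fin n) ℝ) (x₀ : Fin n → ℝ) :
    sampleMatrix N T (epsSignal c β Γ x₀) * firMatrix c β T N = 0 := by
  set F := exp (T • (filterA c)ᵀ) with hF
  set r := Real.exp (-β * T) with hr
  have hsample : ∀ k : ℕ, epsSignal c β Γ x₀ (((k : ℝ) + 1) * T)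
      = (Γ * (F ^ (k + 1) - r ^ (k + 1) • (1 : Matrix (Fin n) (Fin n) ℝ))) *ᵥ x₀ := by
    intro k
    have h1 : (((k : ℝ) + 1) * T) • (filterA c)ᵀ = (k + 1) • (T • (filterA c)ᵀ) := by
      rw [← Nat.cast_smul_eq_nsmul ℝ, smul_smul]
      push_cast
      rfl
    have h2 : Real.exp (-β * (((k : ℝ) + 1) * T)) = r ^ (k + 1) := by
      rw [hr, ← Real.exp_nat_mul]
      congr 1
      push_cast
      ring
    rw [epsSignal, h1, h2, Matrix.exp_nsmul]
  have hp : (firPoly c β T).natDegree + 1 = n + 2 := by rw [firPoly_natDegree]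
  have hpF : ∑ m ∈ Finset.range (n + 2), (firPoly c β T).coeff m • F ^ m = 0 := by
    rw [← hp, ← aeval_eq_sum_range, firPoly, map_mul, aeval_self_charpoly, mul_zero]
  have hpr : ∑ m ∈ Finset.range (n + 2), (firPoly c β T).coeff m * r ^ m = 0 := by
    rw [← hp, ← eval_eq_sum_range, eval_firPoly]
  ext i j
  have h2 : ∑ m ∈ Finset.range (n + 2), (firPoly c β T).coeff m •
      (F ^ ((j : ℕ) + m + 1) - r ^ ((j : ℕ) + m + 1) • (1 : Matrix (Fin n) (Fin n) ℝ)) = 0 := by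
    have h3 : ∀ m, (firPoly c β T).coeff m •
        (F ^ ((j : ℕ) + m + 1) - r ^ ((j : ℕ) + m + 1) • (1 : Matrix (Fin n) (Fin n) ℝ))
        = F ^ ((j : ℕ) + 1) * ((firPoly c β T).coeff m • F ^ m)
          - (r ^ ((j : ℕ) + 1) * ((firPoly c β T).coeff m * r ^ m)) •
            (1 : Matrix (Fin n) (Fin n) ℝ) := by
      intro m
      rw [smul_sub, mul_smul_comm, ← pow_add, smul_smul]
      congr 2
      · congr 1; omega
      · ring
    simp only [h3]
    rw [Finset.sum_sub_distrib, ← Finset.mul_sum, hpF, ← Finset.sum_smul, ← Finset.mul_sum, hpr]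
    simp
  have h4 := congrArg (fun M : Matrix (Fin n) (Fin n) ℝ => ((Γ * M) *ᵥ x₀) i) h2
  rw [sampleMatrix_mul_firMatrix_apply]
  simp only [hsample, Matrix.zero_apply]
  simpa [Matrix.mul_sum, sum_mulVec, Finset.sum_apply, smul_mulVec] using h4

lemma existsUnique_gamma (c : Fin n → ℝ) (β : ℝ)
    (hβ : -(β : ℂ) ∉ complexSpectrum (filterA c)) (G : Matrix (Fin n ⊕ Fin n) (Fin n) ℝ) :
    ∃ Γ : Matrix (Fin n ⊕ Fin n) (Fin n) ℝ, ∀ Γ' : Matrix (Fin n ⊕ Fin n) (Fin n) ℝ,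
      Γ' * (filterA c)ᵀ + β • Γ' = G ↔ Γ' = Γ := by
  set M : Matrix (Fin n) (Fin n) ℝ := (filterA c)ᵀ + β • 1 with hM
  have hdet : IsUnit M.det := by
    rw [isUnit_iff_ne_zero]
    intro h0
    apply hβ
    rw [mem_complexSpectrum_iff]
    have h1 : aeval ((algebraMap ℝ ℂ) (-β)) (filterA c).charpoly = 0 := by
      rw [aeval_algebraMap_apply, coe_aeval_eq_eval, ← charpoly_transpose, eval_charpoly]
      have h2 : scalar (Fin n) (-β) - (filterA c)ᵀ = -M := by
        rw [hM, scalar_apply, ← smul_one_eq_diagonal, neg_smul]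
        abel
      rw [h2, det_neg, h0, mul_zero, map_zero]
    simpa using h1
  refine ⟨G * M⁻¹, fun Γ' => ?_⟩
  have h1 : Γ' * (filterA c)ᵀ + β • Γ' = Γ' * M := by
    rw [hM, Matrix.mul_add, Matrix.mul_smul, Matrix.mul_one]
  rw [h1]
  constructor
  · rintro rfl
    rw [Matrix.mul_assoc, mul_nonsing_inv _ hdet, Matrix.mul_one]
  · rintro rfl
    rw [Matrix.mul_assoc, nonsing_inv_mul _ hdet, Matrix.mul_one]

end Filter

/-! ### Independence of the rows of the filtered data -/

section Assembly

open NormedSpace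

variable {n : ℕ}

/-- The row functional on the state given by weights on `φ` and `υ`. -/
noncomputable def outputRow (v : (Fin n ⊕ Fin n) ⊕ Unit → ℝ) : State n →L[ℝ] ℝ :=
  LinearMap.toContinuousLinearMap
    { toFun := fun s => (fun i => v (Sum.inl i)) ⬝ᵥ s.2.2.2.1 + v (Sum.inr ()) * s.2.2.2.2.1
      map_add' := by
        intro s t
        simp only [Prod.snd_add, Prod.fst_add, dotProduct_add, mul_add]
        ring
      map_smul' := by
        intro r s
        simp only [Prod.smul_snd, Prod.smul_fst, dotProduct_smul, smul_eq_mul, RingHom.id_apply]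
        ring }

lemma outputRow_apply (v : (Fin n ⊕ Fin n) ⊕ Unit → ℝ) (s : State n) :
    outputRow v s = (fun i => v (Sum.inl i)) ⬝ᵥ s.2.2.2.1 + v (Sum.inr ()) * s.2.2.2.2.1 := rfl

/-- The states at the sampling instants, with the held input set to zero, satisfy a linear
recurrence driven by the input. -/
lemma IsTrajectory.state_succ {a b c : Fin n → ℝ} {β : ℝ} {x₀ : Fin n → ℝ} {u : ℝ → ℝ}
    {x ζ μ : ℝ → Fin n → ℝ} {φ : ℝ → Fin n ⊕ Fin n → ℝ} {υ : ℝ → ℝ} {N : ℕ} {T : ℝ} (hT : 0 < T)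
    (h : IsTrajectory a b c β ((N : ℝ) * T) x₀ u x ζ μ φ υ) {d : ℕ → ℝ}
    (hu : ∀ k : ℕ, k < N → ∀ t ∈ Set.Ico ((k : ℝ) * T) (((k : ℝ) + 1) * T), u t = d k)
    {ξ : ℕ → State n}
    (hξ : ∀ k : ℕ, ξ k = (x (k * T), ζ (k * T), μ (k * T), φ (k * T), υ (k * T), 0))
    (k : ℕ) (hk : k < N) :
    ξ (k + 1) = exp (T • generator a b c β) (ξ k) +
      d k • (exp (T • generator a b c β) (inputVec n) - inputVec n) := by
  have hk' : (k : ℝ) * T + T = ((k + 1 : ℕ) : ℝ) * T := by push_cast; ring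
  have hkN : ((k + 1 : ℕ) : ℝ) * T ≤ N * T := by
    gcongr
    exact hk
  have h1 := h.sample_succ (r := k * T) (T := T) (w := d k) (by positivity) hT (hk' ▸ hkN)
    (fun t ht => hu k hk t ⟨ht.1, by linarith [ht.2]⟩)
  rw [hk'] at h1
  have h2 : ∀ (k : ℕ) (w : ℝ), ((x (k * T), ζ (k * T), μ (k * T), φ (k * T), υ (k * T), w) : State n)
      = ξ k + w • inputVec n := by
    intro k w
    simp [hξ, inputVec]
  rw [h2, h2, map_add, map_smul] at h1
  rw [smul_sub, ← add_sub_assoc, ← h1, add_sub_cancel_right]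

/-- The Markov parameters of the filters separate the rows: under the coprimeness assumptions, no
nontrivial combination of `φ` and `υ` has a vanishing response to the input. -/
lemma eq_zero_of_outputRow (hn : 1 ≤ n) (a b c : Fin n → ℝ) (β : ℝ)
    (hab : NoCommonRoot (monicPoly a) (numPoly b)) (hac : NoCommonRoot (monicPoly a) (monicPoly c))
    {v : (Fin n ⊕ Fin n) ⊕ Unit → ℝ}
    (hv : ∀ j : ℕ, outputRow v ((generator a b c β ^ j) (inputVec n)) = 0) : v = 0 := by
  have : NeZero n := ⟨by omega⟩
  set M := generator a b c β with hM
  obtain ⟨P, hPA, hPc⟩ := exists_sylvester a c hac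
  have hvq : ∀ q : ℝ[X], outputRow v (aeval M q (inputVec n)) = 0 := by
    intro q
    rw [apply_aeval]
    exact Finset.sum_eq_zero fun m _ => by rw [hv, mul_zero]
  have hMe : M (inputVec n) = (systemB b, lastVec n, 0, 0, 1, 0) := by
    rw [hM, generator_apply]
    simp [inputVec]
  have hcommM : ∀ (r : ℝ[X]) (s : State n), aeval M r (M s) = M (aeval M r s) := fun r s =>
    congrArg (fun L : State n →L[ℝ] State n => L s)
      (comp_aeval_of_comp_eq (K := M) (M := M) (A := M) rfl r).symm
  -- An observable `L` that evolves by `A` once the held input is absent takes the value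
  -- `r(A) (L (M e))` at `r(M) M e`.
  have hresp : ∀ (L : State n →L[ℝ] (Fin n → ℝ)) (A : Matrix (Fin n) (Fin n) ℝ),
      (∀ s, L (M (M s)) = A *ᵥ L (M s)) → ∀ r : ℝ[X],
      L (aeval M r (M (inputVec n))) = aeval A r *ᵥ L (M (inputVec n)) := by
    intro L A hL r
    have h1 : (L ∘L M) ∘L M = matCLM A ∘L (L ∘L M) := ContinuousLinearMap.ext hL
    have h2 := congrArg (fun K : State n →L[ℝ] (Fin n → ℝ) => K (inputVec n))
      (comp_aeval_of_comp_eq h1 r)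
    simp only [ContinuousLinearMap.comp_apply, aeval_matCLM, matCLM_apply] at h2
    rw [hcommM, h2]
  have hx := hresp prX (systemA a) fun s => by
    rw [hM, prX_apply, generator_apply, prX_apply]
    simp [generator_apply]
  have hζ := hresp prZ (filterA c) fun s => by
    rw [hM, prZ_apply, generator_apply, prZ_apply]
    simp [generator_apply]
  have hμ := hresp (prM - matCLM P ∘L prX) (filterA c) fun s => by
    simp only [_root_.sub_apply, ContinuousLinearMap.comp_apply, matCLM_apply, prM_apply,
      prX_apply]
    set t := M s with ht
    have hw : t.2.2.2.2.2 = 0 := rfl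
    rw [hM, generator_apply]
    simp only [hw, zero_smul, add_zero, mulVec_sub, mulVec_mulVec, hPA, Matrix.add_mulVec]
    have : vecMulVec (lastVec n) (lastVec n) *ᵥ t.1 = (lastVec n ⬝ᵥ t.1) • lastVec n := by
      rw [vecMulVec_mulVec]
      simp
    rw [this]
    abel
  have key : ∀ r : ℝ[X], (fun i => v (Sum.inl (Sum.inl i))) ⬝ᵥ (aeval (filterA c) r *ᵥ lastVec n)
      + (fun i => v (Sum.inl (Sum.inr i))) ⬝ᵥ (P *ᵥ (aeval (systemA a) r *ᵥ systemB b)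
        - aeval (filterA c) r *ᵥ (P *ᵥ systemB b)) = 0 := by
    intro r
    have h1 := hvq ((X + C β) * r * X)
    set s := aeval M r (M (inputVec n)) with hs
    have h2 : aeval M ((X + C β) * r * X) (inputVec n) = M s + β • s := by
      rw [map_mul, map_mul, mul_apply_eq_comp, mul_apply_eq_comp, aeval_X, map_add, aeval_X,
        aeval_C, _root_.add_apply, ContinuousLinearMap.algebraMap_apply]
    have hw : s.2.2.2.2.2 = 0 := by
      rw [hs, hcommM]
      rfl
    have hxs : s.1 = aeval (systemA a) r *ᵥ systemB b := by
      have := hx r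
      rwa [← hs, hMe] at this
    have hζs : s.2.1 = aeval (filterA c) r *ᵥ lastVec n := by
      have := hζ r
      rwa [← hs, hMe] at this
    have hμs : s.2.2.1 = P *ᵥ (aeval (systemA a) r *ᵥ systemB b)
        - aeval (filterA c) r *ᵥ (P *ᵥ systemB b) := by
      have := hμ r
      rw [← hs, hMe] at this
      simp only [_root_.sub_apply, ContinuousLinearMap.comp_apply, matCLM_apply, prM_apply,
        prX_apply, zero_sub, mulVec_neg, hxs] at this
      rw [sub_eq_iff_eq_add] at this
      rw [this]
      abel
    rw [h2, outputRow_apply, hM, generator_apply] at h1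
    rw [← hζs, ← hμs]
    have h3 : (-β • s.2.2.2.1 + Sum.elim s.2.1 s.2.2.1) + β • s.2.2.2.1
        = Sum.elim s.2.1 s.2.2.1 := by
      rw [neg_smul]; abel
    have h4 : (-β * s.2.2.2.2.1 + s.2.2.2.2.2) + β * s.2.2.2.2.1 = 0 := by
      rw [hw]; ring
    simp only [Prod.snd_add, Prod.fst_add, Prod.smul_snd, Prod.smul_fst, smul_eq_mul, h3, h4,
      mul_zero, add_zero] at h1
    rw [← h1]
    simp [dotProduct]
  obtain ⟨h1, h2⟩ := eq_zero_of_filter_response a b c hab hPc key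
  have h3 : v (Sum.inr ()) = 0 := by
    have := hvq X
    rw [aeval_X, hMe, outputRow_apply] at this
    simpa using this
  funext i
  rcases i with (i | i) | i
  · exact congrFun h1 i
  · exact congrFun h2 i
  · exact h3

/-- Every row functional whose filtered data vanish is zero. -/
lemma eq_zero_of_vecMul_data (hn : 1 ≤ n) (a b c : Fin n → ℝ) (β : ℝ)
    (hab : NoCommonRoot (monicPoly a) (numPoly b))
    (hac : NoCommonRoot (monicPoly a) (monicPoly c))
    {T : ℝ} (hT : 0 < T) (hT_np : NonPathological (modes a c β) T)
    {N : ℕ} (hN : 8 * n + 4 ≤ N) {d : ℕ → ℝ} (hd : PersistentlyExciting (4 * n + 2) (N - 1) d)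
    {u : ℝ → ℝ}
    (hu : ∀ k : ℕ, k < N → ∀ t ∈ Set.Ico ((k : ℝ) * T) (((k : ℝ) + 1) * T), u t = d k)
    {x₀ : Fin n → ℝ} {x ζ μ : ℝ → Fin n → ℝ} {φ : ℝ → Fin n ⊕ Fin n → ℝ} {υ : ℝ → ℝ}
    (htraj : IsTrajectory a b c β ((N : ℝ) * T) x₀ u x ζ μ φ υ)
    {v : (Fin n ⊕ Fin n) ⊕ Unit → ℝ}
    (hv : v ᵥ* fromRows (sampleMatrix N T φ * firMatrix c β T N)
      (sampleMatrix N T (fun t (_ : Unit) => υ t) * firMatrix c β T N) = 0) : v = 0 := by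
  have hcomplete : CompleteSpace (State n →L[ℝ] State n) := FiniteDimensional.complete ℝ _
  set M := generator a b c β with hM
  set F := exp (T • M) with hF
  set p := firPoly c β T with hp
  let ξ : ℕ → State n := fun k => (x (k * T), ζ (k * T), μ (k * T), φ (k * T), υ (k * T), 0)
  have hξ := htraj.state_succ hT hu (ξ := ξ) fun k => rfl
  have hpdeg : p.natDegree = n + 1 := firPoly_natDegree c β T
  -- the filtered data are the recurrence of `p`, applied to the samples of the output
  have hrec : ∀ k, 1 ≤ k → k + p.natDegree ≤ N →
      ∑ m ∈ Finset.range (p.natDegree + 1), p.coeff m * outputRow v (ξ (k + m)) = 0 := by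
    intro k hk hkN
    rw [hpdeg] at hkN ⊢
    have h1 := congrFun hv ⟨k - 1, by omega⟩
    rw [Pi.zero_apply] at h1
    rw [← h1]
    have htime : ∀ m : ℕ, (((k - 1 + m : ℕ) : ℝ) + 1) * T = ((k + m : ℕ) : ℝ) * T := by
      intro m
      rw [← Nat.cast_add_one]
      congr 2
      omega
    have h2 : ∀ w : (Fin n ⊕ Fin n) ⊕ Unit → ℝ, v ⬝ᵥ w
        = (fun i => v (Sum.inl i)) ⬝ᵥ (fun i => w (Sum.inl i)) + v (Sum.inr ()) * w (Sum.inr ()) := by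
      intro w
      simp only [dotProduct, Fintype.sum_sum_type (α₁ := Fin n ⊕ Fin n), Finset.univ_unique,
        Finset.sum_singleton]
    rw [vecMul, h2]
    simp only [fromRows_apply_inl, fromRows_apply_inr, sampleMatrix_mul_firMatrix_apply, htime,
      outputRow_apply, ξ]
    simp only [dotProduct, Finset.mul_sum, mul_add, Finset.sum_add_distrib]
    rw [Finset.sum_comm]
    refine congrArg₂ (· + ·) ?_ ?_
    · refine Finset.sum_congr rfl fun i _ => Finset.sum_congr rfl fun m _ => ?_
      ring
    · refine Finset.sum_congr rfl fun m _ => ?_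
      ring
  set q : ℝ[X] := (X - C 1) * (exp (T • systemA a)).charpoly * p with hq
  have hpm : p.Monic := firPoly_monic c β T
  have hqm : q.Monic := ((monic_X_sub_C _).mul (charpoly_monic _)).mul hpm
  have hqdeg : q.natDegree = 2 * n + 2 := by
    rw [hq, ((monic_X_sub_C _).mul (charpoly_monic _)).natDegree_mul hpm,
      (monic_X_sub_C _).natDegree_mul (charpoly_monic _), natDegree_X_sub_C,
      charpoly_natDegree_eq_dim, Fintype.card_fin, hpdeg]
    ring
  have hmarkov := markov_eq_zero (outputRow v) (by omega) hξ (hqm.mul hpm)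
    (aeval_exp_generator a b c β T) (by rw [hqm.natDegree_mul hpm]; omega)
    (recurrence_mul (s := fun k => outputRow v (ξ k)) hpm hqm hrec) hd
  -- telescoping: the sampled step responses vanish
  have hsamp : ∀ k : ℕ, outputRow v ((F ^ k) (inputVec n)) = 0 := by
    intro k
    induction k with
    | zero => simp [outputRow_apply, inputVec]
    | succ k ih =>
      have := hmarkov k
      rw [map_sub, map_sub, ih, sub_zero] at this
      rwa [pow_succ, mul_apply_eq_comp]
  refine eq_zero_of_outputRow hn a b c β hab hac fun j => ?_
  refine apply_pow_eq_zero_of_sampled_real hT.ne' ?_ (aeval_generator_charpoly a b c β) ?_ _ _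
    hsamp j
  · exact ((((monic_X.mul (charpoly_monic _)).mul ((charpoly_monic _).mul (monic_X_add_C _))).mul
      ((charpoly_monic _).mul (monic_X_add_C _)))).ne_zero
  · have hroot : ∀ z : ℂ, aeval z (X * (systemA a).charpoly * ((filterA c).charpoly * (X + C β)) *
        ((filterA c).charpoly * (X + C β))) = 0 → z ∈ modes a c β ∨ z = 0 := by
      intro z hz
      simp only [map_mul, mul_eq_zero, map_add, aeval_X, aeval_C, ← mem_complexSpectrum_iff] at hz
      have hβz : z + (algebraMap ℝ ℂ) β = 0 → z ∈ modes a c β := fun h =>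
        Or.inl (Or.inl (eq_neg_of_add_eq_zero_left h))
      rcases hz with ((h | h) | (h | h)) | (h | h)
      · exact Or.inr h
      · exact Or.inl (Or.inl (Or.inr h))
      · exact Or.inl (Or.inr h)
      · exact Or.inl (hβz h)
      · exact Or.inl (Or.inr h)
      · exact Or.inl (hβz h)
    exact fun l κ hl hκ he => hT_np.exp_injOn hT (hroot l hl) (hroot κ hκ) he

end Assembly

end FilteredData

theorem mainTheorem2 (n : ℕ) (hn : 1 ≤ n) (a b c : Fin n → ℝ) (β : ℝ)
    (hab : FilteredData.NoCommonRoot (FilteredData.monicPoly a) (FilteredData.numPoly b))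
    (hβ : -(β : ℂ) ∉ FilteredData.complexSpectrum (FilteredData.filterA c))
    (hac : FilteredData.NoCommonRoot (FilteredData.monicPoly a) (FilteredData.monicPoly c))
    (T : ℝ) (hT : 0 < T)
    (hT_np : FilteredData.NonPathological (FilteredData.modes a c β) T)
    (N : ℕ) (hN : 8 * n + 4 ≤ N)
    (d : ℕ → ℝ) (hd : FilteredData.PersistentlyExciting (4 * n + 2) (N - 1) d)
    (u : ℝ → ℝ)
    (hu : ∀ k : ℕ, k < N → ∀ t ∈ Set.Ico ((k : ℝ) * T) (((k : ℝ) + 1) * T), u t = d k)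
    (x₀ : Fin n → ℝ) (x ζ μ : ℝ → Fin n → ℝ) (φ : ℝ → Fin n ⊕ Fin n → ℝ) (υ : ℝ → ℝ)
    (htraj : FilteredData.IsTrajectory a b c β ((N : ℝ) * T) x₀ u x ζ μ φ υ) :
    ∃ Γ : Matrix (Fin n ⊕ Fin n) (Fin n) ℝ,
      (∀ Γ' : Matrix (Fin n ⊕ Fin n) (Fin n) ℝ,
        Γ' * (FilteredData.filterA c).transpose + β • Γ' = FilteredData.disturbanceG n ↔
          Γ' = Γ) ∧
      FilteredData.RankConditionWith
        (FilteredData.sampleMatrix N T (FilteredData.epsSignal c β Γ x₀))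
        (FilteredData.sampleMatrix N T φ)
        (FilteredData.sampleMatrix N T (fun t (_ : Unit) => υ t))
        (FilteredData.firMatrix c β T N) ∧
      FilteredData.RankCondition
        (FilteredData.sampleMatrix N T (FilteredData.epsSignal c β Γ x₀))
        (FilteredData.sampleMatrix N T φ)
        (FilteredData.sampleMatrix N T (fun t (_ : Unit) => υ t)) := by
  obtain ⟨Γ, hΓ⟩ := FilteredData.existsUnique_gamma c β hβ (FilteredData.disturbanceG n)
  have hcond : FilteredData.RankConditionWith
      (FilteredData.sampleMatrix N T (FilteredData.epsSignal c β Γ x₀))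
      (FilteredData.sampleMatrix N T φ)
      (FilteredData.sampleMatrix N T (fun t (_ : Unit) => υ t))
      (FilteredData.firMatrix c β T N) := by
    refine ⟨FilteredData.sampleMatrix_epsSignal_mul_firMatrix c β T N Γ x₀, ?_⟩
    have hinj : Function.Injective fun v => v ᵥ* Matrix.fromRows
        (FilteredData.sampleMatrix N T φ * FilteredData.firMatrix c β T N)
        (FilteredData.sampleMatrix N T (fun t (_ : Unit) => υ t) *
          FilteredData.firMatrix c β T N) := by
      intro v w hvw
      rw [← sub_eq_zero]
      refine FilteredData.eq_zero_of_vecMul_data hn a b c β hab hac hT hT_np hN hd hu htraj ?_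
      rw [Matrix.sub_vecMul]
      exact sub_eq_zero.2 hvw
    rw [(Matrix.vecMul_injective_iff.1 hinj).rank_matrix]
    simp [two_mul]
  exact ⟨Γ, hΓ, hcond, _, _, hcond⟩
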